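/- Let $G$ be an H-type group: a connected simply connected Lie group whose Lie algebra $\mathfrak g=\mathfrak v\oplus\mathfrak z$ is stratified of step $2$, with $[\mathfrak v,\mathfrak v]=\mathfrak z\neq 0$ the center of $\mathfrak g$, where $\mathfrak v$ and $\mathfrak z$ carry inner products such that for every $\lambda\in\mathfrak z^*$ the endomorphism $B(\lambda)$ of $\mathfrak v$ representing the form $(U,V)\mapsto\lambda([U,V])$ satisfies $B(\lambda)^2=-|\lambda|^2\,\mathrm{Id}$. Put $\dim\mathfrak v=2d$, $\dim\mathfrak z=p$, identify $G$ with $\mathfrak g$ by the exponential map and let $dx$ be the Lebesgue measure of $\mathfrak g$, a Haar measure of $G$. For $\lambda\in\mathfrak z^*\setminus\{0\}$ choose an orthonormal basis $(P_1,\dots,P_d,Q_1,\dots,Q_d)$ of $\mathfrak v$, depending only on $\lambda/|\lambda|$, in which this form has the matrix $|\lambda|\begin{pmatrix}0&\mathrm{Id}\\-\mathrm{Id}&0\end{pmatrix}$, and let $\pi^\lambda$ be the unitary representation of $G$ on $L^2(\mathbb R^d)$ given by $$\pi^\lambda_x\Phi(\xi)=e^{\,i\lambda(z)+\frac i2|\lambda|\,p\cdot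 q+i\sqrt{|\lambda|}\,\xi\cdot q}\;\Phi\big(\xi+\sqrt{|\lambda|}\,p\big),\qquad x=\mathrm{Exp}\Big(\sum_j p_jP_j+\sum_j q_jQ_j+z\Big),\ z\in\mathfrak z .$$ For $\omega\in\mathfrak v^*$ let $\pi^{(0,\omega)}_{\mathrm{Exp}(v+z)}=e^{i\omega(v)}$. For $f\in\mathcal S(G)$ and each of these representations set $\mathcal Ff(\pi)=\int_G f(x)\,\pi_x^*\,dx$ and write $\mathcal Ff(\lambda)=\mathcal Ff(\pi^\lambda)$. Let $\mathcal A_0$ be the space of the symbols $\sigma=\{\sigma(x,\pi)\}$ of the form $\sigma(x,\pi)=\mathcal F\kappa_x(\pi)$, where $x\mapsto\kappa_x$ is a smooth compactly supported map from $G$ to $\mathcal S(G)$ (the convolution kernel of $\sigma$), and put $$\|\sigma\|_{\mathcal A_0}=\int_G\sup_{x\in G}|\kappa_x(z)|\,dz .$$ For $\varepsilon>0$, $\sigma\in\mathcal A_0$, $f\in\mathcal S(G)$ and $x\in G$ let $$\mathrm{Op}_\varepsilon(\sigma)f(x)=c_0\int_{\mathfrak z^*\setminus\{0\}}\mathrm{Tr}\big(\pi^\lambda_x\,\sigma(x,\varepsilon^2\lambda)\,\mathcal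 Ff(\lambda)\big)\,|\lambda|^d\,d\lambda ,\qquad c_0=(2\pi)^{-(d+p)},$$ where $c_0$ is the constant of the Plancherel formula $\int_G|f|^2dx=c_0\int\|\mathcal Ff(\lambda)\|_{HS}^2|\lambda|^d\,d\lambda$. **Proposition.** There is a constant $C>0$ such that for all $\sigma\in\mathcal A_0$ and all $\varepsilon>0$: for all $f\in\mathcal S(G)$ and $x\in G$ the operators under the trace are of trace class and the integral defining $\mathrm{Op}_\varepsilon(\sigma)f(x)$ converges absolutely, and $\mathrm{Op}_\varepsilon(\sigma)$ extends from $\mathcal S(G)$ to a bounded operator on $L^2(G)$ with $$\|\mathrm{Op}_\varepsilon(\sigma)\|_{\mathcal L(L^2(G))}\le C\,\|\sigma\|_{\mathcal A_0}.$$ -/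

import Mathlib

open MeasureTheory Filter Topology
open scoped SchwartzMap

noncomputable section

namespace HType

/-! ### H-type groups -/

/-- The bracket of an H-type Lie algebra `𝔤 = V ⊕ Z`, where `V` is the first stratum, `Z` is the
center, and both carry a fixed inner product.  The bracket of `v + z` and `v' + z'` is
`bracket v v' ∈ Z`. -/
structure LieStructure (V Z : Type*) [NormedAddCommGroup V] [InnerProductSpace ℝ V]
    [NormedAddCommGroup Z] [InnerProductSpace ℝ Z] where
  /-- the Lie bracket `V × V → Z` -/
  bracket : V →ₗ[ℝ] V →ₗ[ℝ] Z
  bracket_self : ∀ v, bracket v v = 0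
  /-- the algebra has step exactly two -/
  nonabelian : ∃ u v, bracket u v ≠ 0
  /-- `[V, V] = Z` -/
  span_bracket : Submodule.span ℝ {z | ∃ u v, bracket u v = z} = ⊤
  /-- the center of `V ⊕ Z` is not larger than `Z` -/
  center : ∀ u, (∀ v, bracket u v = 0) → u = 0
  /-- `B(lam)² = -|lam|² Id`, where the endomorphism `B` of `V` represents the skew-symmetric
  form `(u, v) ↦ lam [u, v]` -/
  htype : ∀ (lam : Z →L[ℝ] ℝ) (B : V →ₗ[ℝ] V),
    (∀ u v, inner ℝ u (B v) = lam (bracket u v)) → ∀ v, B (B v) = -(‖lam‖ ^ 2) • v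

/-- The H-type group with Lie algebra `V ⊕ Z`, identified with its Lie algebra through the
exponential map: `(v, z)` stands for `Exp (v + z)`, and the group law, which the representations
below encode, is `(v, z) (v', z') = (v + v', z + z' + ½ [v, v'])`.  (The sum of `V × Z` is that of
the Lie algebra.)  Its Haar measure `dx` is the Lebesgue measure
`dv dz`, and its Schwartz space is the Schwartz space of the vector space `V × Z`. -/
abbrev Group (V Z : Type*) := V × Z

/-! ### The representations -/

/-- The underlying space `ℝᵈ`, in the coordinates given by the vectors `P₁, …, P_d`. -/
abbrev Eucl (d : ℕ) := EuclideanSpace ℝ (Fin d)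

/-- The Hilbert space `L²(ℝᵈ)`. -/
abbrev L2 (d : ℕ) := Lp ℂ 2 (volume : Measure (Eucl d))

theorem phase_norm {d : ℕ} (θ : C(Eucl d, ℝ)) (ξ : Eucl d) :
    ‖Complex.exp (Complex.I * (θ ξ : ℂ))‖ = 1 := by
  rw [mul_comm]; exact Complex.norm_exp_ofReal_mul_I _

theorem phase_memLp {d : ℕ} (θ : C(Eucl d, ℝ)) (Φ : L2 d) :
    MemLp (fun ξ => Complex.exp (Complex.I * (θ ξ : ℂ)) * Φ ξ) 2
      (volume : Measure (Eucl d)) := by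
  refine (Lp.memLp Φ).of_le ?_ (Eventually.of_forall fun ξ => ?_)
  · exact (Continuous.aestronglyMeasurable (by fun_prop)).mul (Lp.aestronglyMeasurable Φ)
  · rw [norm_mul, phase_norm, one_mul]

theorem phase_toLp_neg {d : ℕ} (θ : C(Eucl d, ℝ)) (Φ : L2 d) :
    (phase_memLp (-θ) ((phase_memLp θ Φ).toLp)).toLp = Φ := by
  apply Lp.ext
  filter_upwards [(phase_memLp (-θ) ((phase_memLp θ Φ).toLp)).coeFn_toLp,
    (phase_memLp θ Φ).coeFn_toLp] with ξ h1 h2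
  rw [h1, h2, ← mul_assoc, ← Complex.exp_add]
  simp

/-- Multiplication by the phase `exp (i θ)`, a unitary operator of `L²(ℝᵈ)`. -/
def phaseMul {d : ℕ} (θ : C(Eucl d, ℝ)) : L2 d ≃ₗᵢ[ℂ] L2 d where
  toFun Φ := (phase_memLp θ Φ).toLp
  map_add' Φ Ψ := by
    apply Lp.ext
    filter_upwards [(phase_memLp θ (Φ + Ψ)).coeFn_toLp, (phase_memLp θ Φ).coeFn_toLp,
      (phase_memLp θ Ψ).coeFn_toLp, Lp.coeFn_add Φ Ψ,
      Lp.coeFn_add ((phase_memLp θ Φ).toLp) ((phase_memLp θ Ψ).toLp)] with ξ h1 h2 h3 h4 h5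
    rw [h1, h5, Pi.add_apply, h2, h3, h4, Pi.add_apply, mul_add]
  map_smul' c Φ := by
    apply Lp.ext
    filter_upwards [(phase_memLp θ (c • Φ)).coeFn_toLp, (phase_memLp θ Φ).coeFn_toLp,
      Lp.coeFn_smul c Φ, Lp.coeFn_smul c ((phase_memLp θ Φ).toLp)] with ξ h1 h2 h3 h4
    rw [RingHom.id_apply, h1, h4, Pi.smul_apply, h2, h3, Pi.smul_apply, mul_smul_comm]
  invFun Φ := (phase_memLp (-θ) Φ).toLp
  left_inv Φ := phase_toLp_neg θ Φ
  right_inv Φ := by simpa using phase_toLp_neg (-θ) Φ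
  norm_map' Φ := by
    change ‖(phase_memLp θ Φ).toLp‖ = ‖Φ‖
    rw [Lp.norm_toLp, Lp.norm_def]
    congr 1
    refine eLpNorm_congr_norm_ae (Eventually.of_forall fun ξ => ?_)
    rw [norm_mul, phase_norm, one_mul]

theorem translate_cancel {d : ℕ} (a b : Eucl d) (hab : a + b = 0) (Φ : L2 d) :
    Lp.compMeasurePreserving (fun ξ : Eucl d => ξ + b) (measurePreserving_add_right volume b)
      (Lp.compMeasurePreserving (fun ξ : Eucl d => ξ + a) (measurePreserving_add_right volume a) Φ)
      = Φ := by
  apply Lp.ext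
  have h1 := Lp.coeFn_compMeasurePreserving (p := 2)
    (Lp.compMeasurePreserving (fun ξ : Eucl d => ξ + a) (measurePreserving_add_right volume a) Φ)
    (measurePreserving_add_right volume b)
  have h2 := (measurePreserving_add_right volume b).quasiMeasurePreserving.ae_eq
    (Lp.coeFn_compMeasurePreserving Φ (measurePreserving_add_right volume a))
  filter_upwards [h1, h2] with ξ h1 h2
  rw [h1, Function.comp_apply]
  refine h2.trans ?_
  simp [add_assoc, add_comm b a, hab]

/-- The translation `Φ ↦ Φ (· + a)`, a unitary operator of `L²(ℝᵈ)`. -/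
def translate {d : ℕ} (a : Eucl d) : L2 d ≃ₗᵢ[ℂ] L2 d where
  toLinearEquiv :=
    { toLinearMap := (Lp.compMeasurePreservingₗᵢ ℂ (fun ξ : Eucl d => ξ + a)
        (measurePreserving_add_right volume a)).toLinearMap
      invFun := Lp.compMeasurePreserving (fun ξ : Eucl d => ξ + -a)
        (measurePreserving_add_right volume (-a))
      left_inv := fun Φ => translate_cancel a (-a) (by simp) Φ
      right_inv := fun Φ => translate_cancel (-a) a (by simp) Φ }
  norm_map' Φ := (Lp.compMeasurePreservingₗᵢ ℂ (fun ξ : Eucl d => ξ + a)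
        (measurePreserving_add_right volume a)).norm_map Φ

variable {V Z : Type*} [NormedAddCommGroup V] [InnerProductSpace ℝ V]
  [NormedAddCommGroup Z] [InnerProductSpace ℝ Z]

/-- A choice, for every `lam`, of an orthonormal basis `(P₁, …, P_d, Q₁, …, Q_d)` of `V`
(with `P i = basis lam (inl i)` and `Q i = basis lam (inr i)`) in which, for `lam ≠ 0`, the form
`(u, v) ↦ lam [u, v]` has the matrix `|lam| J`, `J = (0, Id; -Id, 0)`.  The basis depends only on
the direction of `lam`, so that the representations `π^lam` and `π^(t lam)`, `t > 0`, act on the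
same space. -/
structure Frame (A : LieStructure V Z) (d : ℕ) where
  basis : (Z →L[ℝ] ℝ) → OrthonormalBasis (Fin d ⊕ Fin d) ℝ V
  basis_smul : ∀ (t : ℝ) (lam : Z →L[ℝ] ℝ), 0 < t → basis (t • lam) = basis lam
  form_eq : ∀ lam : Z →L[ℝ] ℝ, lam ≠ 0 → ∀ i j,
    lam (A.bracket (basis lam i) (basis lam j)) = ‖lam‖ * (Matrix.fromBlocks 0 1 (-1) 0 :
      Matrix (Fin d ⊕ Fin d) (Fin d ⊕ Fin d) ℝ) i j

variable {A : LieStructure V Z} {d : ℕ}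

/-- The coordinates `p` of `v` on `P₁, …, P_d`. -/
def Frame.p (e : Frame A d) (lam : Z →L[ℝ] ℝ) (v : V) : Eucl d :=
  WithLp.toLp 2 fun i => (e.basis lam).repr v (Sum.inl i)

/-- The coordinates `q` of `v` on `Q₁, …, Q_d`. -/
def Frame.q (e : Frame A d) (lam : Z →L[ℝ] ℝ) (v : V) : Eucl d :=
  WithLp.toLp 2 fun i => (e.basis lam).repr v (Sum.inr i)

/-- The phase `lam z + ½ |lam| p·q + √|lam| ξ·q`, as a function of `ξ`. -/
def Frame.phase (e : Frame A d) (lam : Z →L[ℝ] ℝ) (x : Group V Z) : C(Eucl d, ℝ) where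
  toFun ξ := lam x.2 + 1 / 2 * ‖lam‖ * inner ℝ (e.p lam x.1) (e.q lam x.1)
    + √‖lam‖ * inner ℝ ξ (e.q lam x.1)
  continuous_toFun := by fun_prop

/-- The unitary operator `π^lam_x` of `L²(ℝᵈ)`:
`π^lam_x Φ (ξ) = exp (i lam z + (i/2) |lam| p·q + i √|lam| ξ·q) Φ (ξ + √|lam| p)`. -/
def Frame.rep (e : Frame A d) (lam : Z →L[ℝ] ℝ) (x : Group V Z) : L2 d ≃ₗᵢ[ℂ] L2 d :=
  (translate (√‖lam‖ • e.p lam x.1)).trans (phaseMul (e.phase lam x))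

/-! ### The Fourier transform -/

theorem continuous_phaseMul {X : Type*} [TopologicalSpace X] [FirstCountableTopology X]
    (θ : X → C(Eucl d, ℝ)) (hθ : ∀ ξ, Continuous fun x => θ x ξ) (Φ : L2 d) :
    Continuous fun x => phaseMul (θ x) Φ := by
  rw [continuous_iff_continuousAt]
  intro x₀
  rw [ContinuousAt, Lp.tendsto_Lp_iff_tendsto_eLpNorm']
  have key : ∀ x, eLpNorm (⇑(phaseMul (θ x) Φ) - ⇑(phaseMul (θ x₀) Φ)) 2 volume
      = (∫⁻ ξ, ‖(Complex.exp (Complex.I * (θ x ξ : ℂ)) - Complex.exp (Complex.I * (θ x₀ ξ : ℂ)))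
          * Φ ξ‖ₑ ^ (2 : ℝ)) ^ (1 / (2 : ℝ)) := by
    intro x
    rw [eLpNorm_eq_lintegral_rpow_enorm_toReal (by norm_num) (by norm_num)]
    simp only [ENNReal.toReal_ofNat]
    congr 1
    refine lintegral_congr_ae ?_
    filter_upwards [(phase_memLp (θ x) Φ).coeFn_toLp, (phase_memLp (θ x₀) Φ).coeFn_toLp]
      with ξ h1 h2
    rw [Pi.sub_apply, sub_mul, ← h1, ← h2]
    rfl
  simp only [key]
  have h0 : (0 : ENNReal) = (∫⁻ _ : Eucl d, 0) ^ (1 / (2 : ℝ)) := by simp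
  rw [h0]
  refine (ENNReal.continuous_rpow_const.tendsto _).comp ?_
  refine tendsto_lintegral_filter_of_dominated_convergence
    (fun ξ => ‖(2 : ℂ) * Φ ξ‖ₑ ^ (2 : ℝ)) ?_ ?_ ?_ ?_
  · refine Eventually.of_forall fun x => ?_
    refine (Measurable.enorm ?_).pow_const _
    exact (Continuous.measurable (by fun_prop)).mul (Lp.stronglyMeasurable Φ).measurable
  · refine Eventually.of_forall fun x => Eventually.of_forall fun ξ => ?_
    refine ENNReal.rpow_le_rpow ?_ (by norm_num)
    rw [enorm_mul, enorm_mul]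
    gcongr
    rw [enorm_le_iff_norm_le]
    refine (norm_sub_le _ _).trans ?_
    rw [phase_norm, phase_norm]
    norm_num
  · have h := ((Lp.memLp Φ).const_mul (2 : ℂ)).eLpNorm_lt_top
    have h' := (eLpNorm_lt_top_iff_lintegral_rpow_enorm_lt_top (by norm_num) (by norm_num)).1 h
    simpa using h'.ne
  · refine Eventually.of_forall fun ξ => ?_
    have hc : Continuous fun x => ‖(Complex.exp (Complex.I * (θ x ξ : ℂ))
        - Complex.exp (Complex.I * (θ x₀ ξ : ℂ))) * Φ ξ‖ₑ ^ (2 : ℝ) := by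
      have := hθ ξ
      refine ENNReal.continuous_rpow_const.comp (continuous_enorm.comp ?_)
      fun_prop
    simpa using hc.tendsto x₀

theorem continuous_translate (Φ : L2 d) : Continuous fun a : Eucl d => translate a Φ := by
  refine Continuous.compMeasurePreservingLp (p := 2) (f := fun _ : Eucl d => Φ)
    (g := fun a : Eucl d => (⟨fun ξ => ξ + a, by fun_prop⟩ : C(Eucl d, Eucl d)))
    continuous_const ?_ (fun a => measurePreserving_add_right volume a) (by norm_num)
  refine ContinuousMap.continuous_of_continuous_uncurry _ ?_
  change Continuous fun y : Eucl d × Eucl d => y.2 + y.1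
  fun_prop

/-- The representation `π^lam` is strongly continuous. -/
theorem Frame.continuous_rep (e : Frame A d) (lam : Z →L[ℝ] ℝ) (Φ : L2 d) :
    Continuous fun x : Group V Z => e.rep lam x Φ := by
  have hp : Continuous fun x : Group V Z => e.p lam x.1 := by
    unfold Frame.p; fun_prop
  have hq : Continuous fun x : Group V Z => e.q lam x.1 := by
    unfold Frame.q; fun_prop
  have ht : Continuous fun x : Group V Z => translate (√‖lam‖ • e.p lam x.1) Φ :=
    (continuous_translate Φ).comp (by fun_prop)
  have hθ : ∀ ξ, Continuous fun x : Group V Z => e.phase lam x ξ := by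
    intro ξ
    change Continuous fun x : Group V Z => lam x.2
      + 1 / 2 * ‖lam‖ * inner ℝ (e.p lam x.1) (e.q lam x.1) + √‖lam‖ * inner ℝ ξ (e.q lam x.1)
    fun_prop
  rw [continuous_iff_continuousAt]
  intro x₀
  rw [ContinuousAt, tendsto_iff_norm_sub_tendsto_zero]
  have h1 := tendsto_iff_norm_sub_tendsto_zero.1 (ht.tendsto x₀)
  have h2 := tendsto_iff_norm_sub_tendsto_zero.1
    ((continuous_phaseMul _ hθ (translate (√‖lam‖ • e.p lam x₀.1) Φ)).tendsto x₀)
  refine squeeze_zero (fun _ => norm_nonneg _) (fun x => ?_) (by simpa using h1.add h2)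
  rw [← (phaseMul (e.phase lam x)).norm_map
    (translate (√‖lam‖ • e.p lam x.1) Φ - translate (√‖lam‖ • e.p lam x₀.1) Φ), map_sub]
  exact norm_sub_le_norm_sub_add_norm_sub _ _ _

theorem Frame.continuous_rep_symm (e : Frame A d) (lam : Z →L[ℝ] ℝ) (Φ : L2 d) :
    Continuous fun x : Group V Z => (e.rep lam x).symm Φ := by
  rw [continuous_iff_continuousAt]
  intro x₀
  rw [ContinuousAt, tendsto_iff_norm_sub_tendsto_zero]
  have h1 := tendsto_iff_norm_sub_tendsto_zero.1
    ((e.continuous_rep lam ((e.rep lam x₀).symm Φ)).tendsto x₀)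
  refine h1.congr fun x => ?_
  rw [← (e.rep lam x).norm_map ((e.rep lam x).symm Φ - (e.rep lam x₀).symm Φ), map_sub,
    LinearIsometryEquiv.apply_symm_apply, LinearIsometryEquiv.apply_symm_apply, norm_sub_rev]

variable [FiniteDimensional ℝ V] [FiniteDimensional ℝ Z]
  [MeasurableSpace V] [BorelSpace V] [MeasurableSpace Z] [BorelSpace Z]

instance : (volume : Measure (Group V Z)).IsAddHaarMeasure :=
  inferInstanceAs ((volume : Measure V).prod (volume : Measure Z)).IsAddHaarMeasure

theorem Frame.integrable_rep_symm (e : Frame A d) (lam : Z →L[ℝ] ℝ) (f : 𝓢(Group V Z, ℂ))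
    (Φ : L2 d) : Integrable fun x : Group V Z => f x • (e.rep lam x).symm Φ := by
  refine Integrable.mono' (f.integrable.norm.mul_const ‖Φ‖) ?_ (Eventually.of_forall fun x => ?_)
  · exact (f.continuous.smul (e.continuous_rep_symm lam Φ)).aestronglyMeasurable
  · rw [norm_smul, LinearIsometryEquiv.norm_map]

/-- The Fourier transform `𝓕 f (lam) = ∫ f(x) (π^lam_x)^* dx`, a bounded operator of `L²(ℝᵈ)`;
the integral is taken in the strong sense, and the adjoint of the unitary operator `π^lam_x` is
its inverse. -/
def Frame.fourier (e : Frame A d) (f : 𝓢(Group V Z, ℂ)) (lam : Z →L[ℝ] ℝ) : L2 d →L[ℂ] L2 d :=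
  LinearMap.mkContinuous
    { toFun := fun Φ => ∫ x : Group V Z, f x • (e.rep lam x).symm Φ
      map_add' := fun Φ Ψ => by
        simp only [map_add, smul_add]
        exact integral_add (e.integrable_rep_symm lam f Φ) (e.integrable_rep_symm lam f Ψ)
      map_smul' := fun c Φ => by
        simp only [map_smul, RingHom.id_apply, smul_comm _ c]
        exact integral_smul c _ }
    (∫ x : Group V Z, ‖f x‖)
    (fun Φ => by
      refine (norm_integral_le_integral_norm _).trans (le_of_eq ?_)
      rw [← integral_mul_const]
      simp only [norm_smul, LinearIsometryEquiv.norm_map])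

/-- The Fourier transform at the one-dimensional representation `π^(0,ω)`:
`𝓕 f (0, ω) = ∫ f(Exp (v + z)) exp (-i ω(v)) dv dz`. -/
def fourierChar (f : 𝓢(Group V Z, ℂ)) (ω : V →L[ℝ] ℝ) : ℂ :=
  ∫ x : Group V Z, f x * Complex.exp (-(Complex.I * (ω x.1 : ℂ)))

/-! ### Trace-class operators -/

/-- Hilbert-Schmidt operators: `∑ ‖T bᵢ‖² < ∞` for all Hilbert bases `b`. -/
def IsHilbertSchmidt {H : Type} [NormedAddCommGroup H] [InnerProductSpace ℂ H]
    (T : H →L[ℂ] H) : Prop :=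
  ∀ (ι : Type) (b : HilbertBasis ι ℂ H), Summable fun i => ‖T (b i)‖ ^ 2

/-- Trace-class operators: the products of two Hilbert-Schmidt operators. -/
def IsTraceClass {H : Type} [NormedAddCommGroup H] [InnerProductSpace ℂ H]
    (T : H →L[ℂ] H) : Prop :=
  ∃ S R : H →L[ℂ] H, IsHilbertSchmidt S ∧ IsHilbertSchmidt R ∧ T = S ∘L R

/-- The trace `∑ ⟨bᵢ, T bᵢ⟩` of a trace-class operator, in some Hilbert basis `b` (it does not
depend on `b`). -/
def trace {H : Type} [NormedAddCommGroup H] [InnerProductSpace ℂ H] [CompleteSpace H]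
    (T : H →L[ℂ] H) : ℂ :=
  ∑' i, inner ℂ ((exists_hilbertBasis ℂ H).choose_spec.choose i)
    (T ((exists_hilbertBasis ℂ H).choose_spec.choose i))

/-! ### Symbols and their quantization -/

/-- Differentiability of order `n` of a map `f` with values in a topological vector space, on a
finite-dimensional space: all iterated directional derivatives up to order `n` exist and are
continuous. -/
def IsCn {E F : Type*} [NormedAddCommGroup E] [NormedSpace ℝ E] [AddCommGroup F] [Module ℝ F]
    [TopologicalSpace F] [ContinuousSMul ℝ F] : ℕ → (E → F) → Prop
  | 0, f => Continuous f
  | n + 1, f => Continuous f ∧ ∃ f' : E → E → F,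
      (∀ v x, HasDerivAt (fun t : ℝ => f (x + t • v)) (f' v x) 0) ∧ ∀ v, IsCn n (f' v)

/-- Smooth and compactly supported maps `x ↦ κ_x` from the group `G` to `𝓢(G)`. -/
structure IsSmoothCompact (κ : Group V Z → 𝓢(Group V Z, ℂ)) : Prop where
  smooth : ∀ n, IsCn n κ
  compact : HasCompactSupport κ

/-- Symbols: fields of operators `σ(x, π)` indexed by `x ∈ G` and the irreducible unitary
representations `π` of `G`, which are `π^lam` for `lam ≠ 0` (acting on `L²(ℝᵈ)`) and the
characters `π^(0,ω)`.  The value of `op` at `lam = 0` is never used. -/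
structure Symbol (V Z : Type*) [NormedAddCommGroup V] [InnerProductSpace ℝ V]
    [NormedAddCommGroup Z] [InnerProductSpace ℝ Z] (d : ℕ) where
  op : Group V Z → (Z →L[ℝ] ℝ) → (L2 d →L[ℂ] L2 d)
  char : Group V Z → (V →L[ℝ] ℝ) → ℂ

/-- `κ` is the convolution kernel of the symbol `σ`: it is a smooth and compactly supported map
from `G` to `𝓢(G)`, and `σ(x, ·) = 𝓕 κ_x`.  The algebra `𝓐₀` consists of the symbols that have a
convolution kernel. -/
structure IsConvolutionKernel (e : Frame A d) (κ : Group V Z → 𝓢(Group V Z, ℂ))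
    (σ : Symbol V Z d) : Prop where
  smooth_compact : IsSmoothCompact κ
  op_eq : ∀ x lam, lam ≠ 0 → σ.op x lam = e.fourier (κ x) lam
  char_eq : ∀ x ω, σ.char x ω = fourierChar (κ x) ω

/-- The norm `‖σ‖ = ∫ sup_x |κ_x(z)| dz` of a symbol in `𝓐₀` with convolution kernel `κ`. -/
def normA0 (κ : Group V Z → 𝓢(Group V Z, ℂ)) : ℝ :=
  ∫ z : Group V Z, ⨆ x : Group V Z, ‖κ x z‖

/-- The Lebesgue measure of the dual of `Z`, for the inner product dual to that of `Z`. -/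
def dualVolume (Z : Type*) [NormedAddCommGroup Z] [InnerProductSpace ℝ Z] [FiniteDimensional ℝ Z]
    [MeasurableSpace Z] [BorelSpace Z] : Measure (Z →L[ℝ] ℝ) :=
  (volume : Measure Z).map fun z => innerSL ℝ z

/-- The constant `c₀ = (2π)^(-(d + dim Z))` of the Plancherel formula
`∫ |f|² dx = c₀ ∫ ‖𝓕 f (lam)‖²_HS |lam|^d dlam`. -/
def c0 (Z : Type*) [AddCommGroup Z] [Module ℝ Z] (d : ℕ) : ℝ :=
  ((2 * Real.pi) ^ (d + Module.finrank ℝ Z))⁻¹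

/-- The operator `π^lam_x σ(x, ε² lam) 𝓕 f (lam)` of `L²(ℝᵈ)`. -/
def Frame.quantOp (e : Frame A d) (σ : Symbol V Z d) (ε : ℝ) (f : 𝓢(Group V Z, ℂ))
    (x : Group V Z) (lam : Z →L[ℝ] ℝ) : L2 d →L[ℂ] L2 d :=
  (e.rep lam x : L2 d →L[ℂ] L2 d) ∘L σ.op x (ε ^ 2 • lam) ∘L e.fourier f lam

/-- The integrand `Tr (π^lam_x σ(x, ε² lam) 𝓕 f (lam)) |lam|^d`. -/
def Frame.quantIntegrand (e : Frame A d) (σ : Symbol V Z d) (ε : ℝ) (f : 𝓢(Group V Z, ℂ))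
    (x : Group V Z) (lam : Z →L[ℝ] ℝ) : ℂ :=
  trace (e.quantOp σ ε f x lam) * (‖lam‖ ^ d : ℝ)

/-- The semi-classical quantization
`Op_ε(σ) f (x) = c₀ ∫_{lam ≠ 0} Tr (π^lam_x σ(x, ε² lam) 𝓕 f (lam)) |lam|^d dlam`. -/
def Frame.Op (e : Frame A d) (ε : ℝ) (σ : Symbol V Z d) (f : 𝓢(Group V Z, ℂ))
    (x : Group V Z) : ℂ :=
  c0 Z d * ∫ lam in {lam : Z →L[ℝ] ℝ | lam ≠ 0}, e.quantIntegrand σ ε f x lam ∂dualVolume Z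

end HType

end

set_option linter.unusedSectionVars false

open MeasureTheory Filter Topology
open scoped SchwartzMap ENNReal

noncomputable section

namespace HType

/-! The quantization is a convolution with a kernel that varies with the point: `Op_ε(σ) f (x) = ∫
κ_x(y) f(x (δ_ε y)⁻¹) dy`, where `δ_ε` is the dilation (`Frame.op_eq`). Given this, `|Op_ε(σ) f
(x)|` is at most the integral of `w(y) |f(x (δ_ε y)⁻¹)|` with `w(y) = sup_x |κ_x(y)|`. Since `x ↦ x
a⁻¹` preserves Lebesgue measure, the `L²` norm is at most `‖w‖_{L¹} ‖f‖`, so that `C = 1` works for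
every `ε` (`LieStructure.lintegral_convolution_sq_le`). Density of the Schwartz functions gives the
extension.

The formula comes from Plancherel, applied to a trace that is rewritten as a Hilbert-Schmidt inner
product. As `π^(ε² lam)_y = π^lam_(δ_ε y)` and `π^lam_x (π^lam_a)^* = π^lam_(x a⁻¹)`, the operator
`π^lam_x 𝓕 κ_x (ε² lam)` is the adjoint of `𝓕 h (lam)` for a Schwartz function `h`, obtained from
the conjugate of `κ_x` by the affine substitution `w = x (δ_ε y)⁻¹` (`Frame.inner_rep_fourier`). The
trace is therefore `∑ ⟨𝓕 h (lam) bᵢ, 𝓕 f (lam) bᵢ⟩`.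

Write `f^lam` for the partial Fourier transform of `f` in the center. The operator `𝓕 f (lam)` has
an explicit integral kernel, built from the Fourier transform of `f^lam` in `q`. Parseval in `p` and
Plancherel in `q` give `‖𝓕 f (lam)‖²_HS = (2π)^d |lam|^(-d) ‖f^lam‖²`
(`Frame.tsum_enorm_fourier_sq`), and polarization gives the inner products
(`Frame.hasSum_inner_fourier`). The weight `|lam|^d` cancels, and Plancherel in the center
(`integral_inner_centralFourier`) turns the integral over `lam` into a multiple of `∫ conj(h) f`,
with the constant `1 / c₀`; undoing the substitution yields the formula. -/

theorem lintegral_enorm_sq {X : Type*} [MeasurableSpace X] {μ : Measure X} (F : X → ℂ) :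
    ∫⁻ x, ‖F x‖ₑ ^ 2 ∂μ = eLpNorm F 2 μ ^ 2 := by
  rw [eLpNorm_eq_lintegral_rpow_enorm_toReal (by norm_num) (by norm_num)]
  simp only [ENNReal.toReal_ofNat, one_div]
  rw [← ENNReal.rpow_natCast, ← ENNReal.rpow_mul]
  simp

theorem memLp_two_iff {X : Type*} [MeasurableSpace X] {μ : Measure X} {H : X → ℂ} :
    MemLp H 2 μ ↔ AEStronglyMeasurable H μ ∧ ∫⁻ s, ‖H s‖ₑ ^ 2 ∂μ < ⊤ := by
  rw [MemLp, eLpNorm_lt_top_iff_lintegral_rpow_enorm_lt_top (by norm_num) (by norm_num)]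
  simp

theorem MemLp.lintegral_enorm_sq_eq {X : Type*} [MeasurableSpace X] {μ : Measure X} {F : X → ℂ}
    (h : MemLp F 2 μ) : ∫⁻ x, ‖F x‖ₑ ^ 2 ∂μ = ENNReal.ofReal (‖h.toLp F‖ ^ 2) := by
  rw [ENNReal.ofReal_pow (norm_nonneg _), ofReal_norm, Lp.enorm_def,
    eLpNorm_congr_ae h.coeFn_toLp, lintegral_enorm_sq]

/-! ### Euclidean Plancherel formula for the angular-frequency Fourier transform -/

section Plancherel

open FourierTransform
variable {E : Type*} [NormedAddCommGroup E] [InnerProductSpace ℝ E] [FiniteDimensional ℝ E]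
  [MeasurableSpace E] [BorelSpace E]

/-- The `L²` transform is defined by extension, so the two sides are compared as distributions:
against a test function both equal the integral of `φ` times the transform of that function. -/
theorem fourier_toLp_ae_eq {φ : E → ℂ} (h1 : Integrable φ) (h2 : MemLp φ 2) :
    ⇑(𝓕 (h2.toLp φ) : Lp ℂ 2 (volume : Measure E)) =ᵐ[volume] 𝓕 φ := by
  have hc : Continuous (𝓕 φ) :=
    VectorFourier.fourierIntegral_continuous Real.continuous_fourierChar
      (by exact continuous_inner) h1
  refine ae_eq_of_integral_contDiff_smul_eq
    ((Lp.memLp (𝓕 (h2.toLp φ) : Lp ℂ 2 (volume : Measure E))).locallyIntegrable (by norm_num))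
    hc.locallyIntegrable ?_
  intro g hg hgs
  have hgs' : HasCompactSupport fun x => (g x : ℂ) :=
    hgs.comp_left (g := fun r : ℝ => (r : ℂ)) (by simp)
  have hg' : ContDiff ℝ ((⊤ : ℕ∞) : WithTop ℕ∞) fun x => (g x : ℂ) :=
    Complex.ofRealCLM.contDiff.comp hg
  let ψ : 𝓢(E, ℂ) := hgs'.toSchwartzMap hg'
  have hψ : ∀ x, ψ x = (g x : ℂ) := fun x => rfl
  have e1 : ∀ (F : E → ℂ), ∫ x, g x • F x = ∫ x, ψ x • F x := by
    intro F
    simp only [hψ, smul_eq_mul, Complex.real_smul]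
  rw [e1, e1]
  have e2 := Lp.toTemperedDistribution_apply (𝓕 (h2.toLp φ) : Lp ℂ 2 (volume : Measure E)) ψ
  rw [← e2, ← Lp.fourier_toTemperedDistribution_eq, TemperedDistribution.fourier_apply,
    Lp.toTemperedDistribution_apply]
  have e3 : ∫ x, (𝓕 ψ) x • (h2.toLp φ) x = ∫ x, (𝓕 ψ) x • φ x := by
    refine integral_congr_ae ?_
    filter_upwards [h2.coeFn_toLp] with x hx
    rw [hx]
  rw [e3, SchwartzMap.fourier_coe]
  have := VectorFourier.integral_fourierIntegral_smul_eq_flip (μ := volume) (ν := volume)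
    (e := Real.fourierChar) (L := innerₗ E) Real.continuous_fourierChar continuous_inner
    ψ.integrable h1
  rw [flip_innerₗ] at this
  exact this

/-- The Fourier integral `∫ φ(q) exp (-i ⟨q, s⟩) dq`. -/
def angularFourier (φ : E → ℂ) (s : E) : ℂ :=
  ∫ q, φ q * Complex.exp (-(Complex.I * (inner ℝ q s : ℝ)))

theorem angularFourier_smul (φ : E → ℂ) (s : E) :
    angularFourier φ ((2 * Real.pi) • s) = 𝓕 φ s := by
  rw [Real.fourier_eq', angularFourier]
  refine integral_congr_ae (Eventually.of_forall fun q => ?_)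
  simp only [smul_eq_mul, inner_smul_right]
  rw [mul_comm]
  congr 2
  push_cast
  ring

theorem lintegral_smul_eq (F : E → ℝ≥0∞) {r : ℝ} (hr : 0 < r) :
    ∫⁻ s, F s = ENNReal.ofReal (r ^ Module.finrank ℝ E) * ∫⁻ s, F (r • s) := by
  have h := Measure.map_addHaar_smul (volume : Measure E) hr.ne'
  have h2 : ∫⁻ s, F (r • s) = ∫⁻ s, F s ∂(Measure.map (r • ·) volume) :=
    ((Homeomorph.smulOfNeZero r hr.ne').measurableEmbedding.lintegral_map F).symm
  rw [h2, h, lintegral_smul_measure, smul_eq_mul, ← mul_assoc, abs_of_pos (by positivity),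
    ← ENNReal.ofReal_mul (by positivity), mul_inv_cancel₀ (by positivity), ENNReal.ofReal_one,
    one_mul]

theorem integral_smul_eq (F : E → ℂ) {r : ℝ} (hr : 0 < r) :
    ∫ s, F s = (r ^ Module.finrank ℝ E : ℝ) * ∫ s, F (r • s) := by
  rw [Measure.integral_comp_smul_of_nonneg (volume : Measure E) F r (hR := hr.le),
    Complex.real_smul, ← mul_assoc, ← Complex.ofReal_mul, mul_inv_cancel₀ (by positivity), Complex.ofReal_one, one_mul]

/-- The unitary transform has frequency `s / 2π`; the constant is the Jacobian of this rescaling. -/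
theorem lintegral_angularFourier {φ : E → ℂ} (h1 : Integrable φ) (h2 : MemLp φ 2) :
    ∫⁻ s, ‖angularFourier φ s‖ₑ ^ 2
      = ENNReal.ofReal ((2 * Real.pi) ^ Module.finrank ℝ E) * ∫⁻ q, ‖φ q‖ₑ ^ 2 := by
  rw [lintegral_smul_eq _ (r := 2 * Real.pi) (by positivity)]
  congr 1
  simp only [angularFourier_smul]
  have h : ‖(𝓕 (h2.toLp φ) : Lp ℂ 2 (volume : Measure E))‖ₑ = ‖h2.toLp φ‖ₑ := by
    rw [← ofReal_norm, ← ofReal_norm, Lp.norm_fourier_eq]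
  rw [Lp.enorm_def, Lp.enorm_def, eLpNorm_congr_ae (fourier_toLp_ae_eq h1 h2),
    eLpNorm_congr_ae h2.coeFn_toLp] at h
  rw [lintegral_enorm_sq, lintegral_enorm_sq, h]

theorem integral_conj_angularFourier {φ ψ : E → ℂ} (h1 : Integrable φ) (h2 : MemLp φ 2)
    (k1 : Integrable ψ) (k2 : MemLp ψ 2) :
    ∫ s, starRingEnd ℂ (angularFourier φ s) * angularFourier ψ s
      = ((2 * Real.pi) ^ Module.finrank ℝ E : ℝ) * ∫ q, starRingEnd ℂ (φ q) * ψ q := by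
  rw [integral_smul_eq _ (r := 2 * Real.pi) (by positivity)]
  congr 1
  simp only [angularFourier_smul]
  have h := Lp.inner_fourier_eq (h2.toLp φ) (k2.toLp ψ)
  rw [L2.inner_def, L2.inner_def] at h
  have a1 : ∫ s, starRingEnd ℂ (𝓕 φ s) * 𝓕 ψ s
      = ∫ s, inner ℂ ((𝓕 (h2.toLp φ) : Lp ℂ 2 volume) s) ((𝓕 (k2.toLp ψ) : Lp ℂ 2 volume) s) := by
    refine integral_congr_ae ?_
    filter_upwards [fourier_toLp_ae_eq h1 h2, fourier_toLp_ae_eq k1 k2] with s p1 p2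
    rw [p1, p2, RCLike.inner_apply, mul_comm]
  have a2 : ∫ s, starRingEnd ℂ (φ s) * ψ s
      = ∫ s, inner ℂ ((h2.toLp φ : Lp ℂ 2 volume) s) ((k2.toLp ψ : Lp ℂ 2 volume) s) := by
    refine integral_congr_ae ?_
    filter_upwards [h2.coeFn_toLp, k2.coeFn_toLp] with s p1 p2
    rw [p1, p2, RCLike.inner_apply, mul_comm]
  rw [a1, a2, h]

end Plancherel

/-! ### Parseval's identity in Hilbert bases -/

section HilbertBasis

/-- Distinct basis vectors are at distance `√2 > 1`, so the balls of radius `1/2` around them are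
disjoint and open. Countability is what allows sums over the basis to be exchanged with integrals.
-/
theorem countable_of_hilbertBasis {H ι : Type*} [NormedAddCommGroup H] [InnerProductSpace ℂ H]
    [TopologicalSpace.SeparableSpace H] (b : HilbertBasis ι ℂ H) : Countable ι := by
  have hd : Pairwise (Function.onFun Disjoint fun i => Metric.ball (b i) (1 / 2)) := by
    intro i j hij
    refine Metric.ball_disjoint_ball ?_
    have h1 : ‖b i - b j‖ ^ 2 = 2 := by
      rw [@norm_sub_sq ℂ, b.orthonormal.1 i, b.orthonormal.1 j, b.orthonormal.2 hij]
      norm_num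
    rw [dist_eq_norm]
    nlinarith [norm_nonneg (b i - b j)]
  exact Pairwise.countable_of_isOpen_disjoint hd (fun i => Metric.isOpen_ball)
    (fun i => Metric.nonempty_ball.2 (by norm_num))

theorem tsum_enorm_inner_sq {H ι : Type*} [NormedAddCommGroup H] [InnerProductSpace ℂ H]
    (b : HilbertBasis ι ℂ H) (x : H) : ∑' i, ‖inner ℂ x (b i)‖ₑ ^ 2 = ‖x‖ₑ ^ 2 := by
  have h := b.hasSum_inner_mul_inner x x
  have h' : HasSum (fun i => ‖inner ℂ x (b i)‖ ^ 2) (‖x‖ ^ 2) := by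
    rw [inner_self_eq_norm_sq_to_K] at h
    have h3 := Complex.hasSum_re h
    convert h3 using 1
    · funext i
      rw [← inner_conj_symm, ← inner_conj_symm (b i) x, Complex.conj_conj, Complex.mul_conj,
        Complex.normSq_eq_norm_sq,
        Complex.ofReal_re]
    · simp [← Complex.ofReal_pow]
  have h2 : ∀ y : ℝ, 0 ≤ y → ENNReal.ofReal (y ^ 2) = ENNReal.ofReal y ^ 2 :=
    fun y hy => ENNReal.ofReal_pow hy 2
  simp only [← ofReal_norm]
  rw [← h2 _ (norm_nonneg _), ← h'.tsum_eq, ENNReal.ofReal_tsum_of_nonneg (fun i => sq_nonneg _)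
    h'.summable]
  simp only [h2 _ (norm_nonneg _)]

theorem tsum_enorm_integral_sq {X ι : Type*} [MeasurableSpace X] {μ : Measure X}
    (b : HilbertBasis ι ℂ (Lp ℂ 2 μ)) {K : X → ℂ} (hK : MemLp K 2 μ) :
    ∑' i, ‖∫ y, K y * b i y ∂μ‖ₑ ^ 2 = ∫⁻ y, ‖K y‖ₑ ^ 2 ∂μ := by
  have hK' : MemLp (fun y => starRingEnd ℂ (K y)) 2 μ := hK.star
  have h := tsum_enorm_inner_sq b (hK'.toLp _)
  have e : ∀ i, inner ℂ (hK'.toLp _) (b i) = ∫ y, K y * b i y ∂μ := by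
    intro i
    rw [L2.inner_def]
    refine integral_congr_ae ?_
    filter_upwards [hK'.coeFn_toLp] with y hy
    rw [hy, RCLike.inner_apply, Complex.conj_conj, mul_comm]
  simp only [e] at h
  rw [h, Lp.enorm_def, eLpNorm_congr_ae hK'.coeFn_toLp, lintegral_enorm_sq]
  congr 1
  exact eLpNorm_congr_norm_ae (Eventually.of_forall fun y => RCLike.norm_conj _)

end HilbertBasis

/-- A Bochner integral in `L²` is computed pointwise. -/
theorem coeFn_integral_ae_eq {X Y : Type*} [MeasurableSpace X] [MeasurableSpace Y] {μ : Measure X}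
    {ν : Measure Y} [SigmaFinite μ] [SigmaFinite ν] {u : X → Lp ℂ 2 ν} (hu : Integrable u μ)
    {U : X → Y → ℂ} (hU : AEStronglyMeasurable (Function.uncurry U) (μ.prod ν))
    (huU : ∀ x, u x =ᵐ[ν] U x) :
    (∀ᵐ y ∂ν, Integrable (fun x => U x y) μ) ∧
      ⇑(∫ x, u x ∂μ) =ᵐ[ν] fun y => ∫ x, U x y ∂μ := by
  -- On a set of finite measure, Cauchy-Schwarz bounds the `L¹` norm of `U x` by a multiple of `‖u
  -- x‖`, which is integrable. Fubini is thus available on such sets, and they suffice to identify a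
  -- function almost everywhere.
  have key : ∀ s, MeasurableSet s → ν s < ⊤ →
      Integrable (Function.uncurry U) (μ.prod (ν.restrict s)) := by
    intro s hs hνs
    have : IsFiniteMeasure (ν.restrict s) := ⟨by simpa using hνs⟩
    have hUs : AEStronglyMeasurable (Function.uncurry U) (μ.prod (ν.restrict s)) :=
      hU.mono_ac (Measure.AbsolutelyContinuous.rfl.prod
        Measure.restrict_le_self.absolutelyContinuous)
    have hm : ∀ x, MemLp (U x) 2 (ν.restrict s) := fun x =>
      ((memLp_congr_ae (huU x)).1 (Lp.memLp (u x))).restrict s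
    refine (integrable_prod_iff hUs).2
      ⟨Eventually.of_forall fun x => (hm x).integrable (by norm_num), ?_⟩
    refine Integrable.mono' (hu.norm.mul_const (ν.real s ^ (1 / 2 : ℝ)))
      hUs.norm.integral_prod_right' (Eventually.of_forall fun x => ?_)
    rw [Real.norm_of_nonneg (integral_nonneg fun y => norm_nonneg _)]
    simp only [Function.uncurry_apply_pair]
    rw [integral_norm_eq_lintegral_enorm (hm x).1, ← eLpNorm_one_eq_lintegral_enorm]
    have h1 := eLpNorm_le_eLpNorm_mul_rpow_measure_univ (p := 1) (q := 2) (by norm_num) (hm x).1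
    have h2 : eLpNorm (U x) 2 (ν.restrict s) ≤ eLpNorm (u x) 2 ν :=
      (eLpNorm_mono_measure _ Measure.restrict_le_self).trans_eq (eLpNorm_congr_ae (huU x).symm)
    have h3 : eLpNorm (U x) 1 (ν.restrict s) ≤ eLpNorm (u x) 2 ν * ν s ^ (1 / 2 : ℝ) := by
      refine h1.trans ?_
      rw [Measure.restrict_apply_univ]
      norm_num
      gcongr
    have h4 : eLpNorm (u x) 2 ν * ν s ^ (1 / 2 : ℝ) ≠ ⊤ :=
      ENNReal.mul_ne_top (Lp.eLpNorm_ne_top _)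
        (ENNReal.rpow_ne_top_of_nonneg (by norm_num) hνs.ne)
    refine (ENNReal.toReal_mono h4 h3).trans_eq ?_
    rw [ENNReal.toReal_mul, ← ENNReal.toReal_rpow, Lp.norm_def]
    rfl
  refine ⟨ae_of_forall_measure_lt_top_ae_restrict _ fun s hs hνs => (key s hs hνs).prod_left_ae, ?_⟩
  refine ae_eq_of_forall_setIntegral_eq_of_sigmaFinite ?_
    (fun s hs hνs => (key s hs hνs).integral_prod_right) ?_
  · intro s hs hνs
    have : IsFiniteMeasure (ν.restrict s) := ⟨by simpa using hνs⟩
    exact ((Lp.memLp _).restrict s).integrable (by norm_num)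
  · intro s hs hνs
    rw [← L2.inner_indicatorConstLp_one (𝕜 := ℂ) hs hνs.ne, ← integral_inner hu]
    simp only [L2.inner_indicatorConstLp_one]
    rw [← integral_integral_swap (key s hs hνs)]
    refine integral_congr_ae (Eventually.of_forall fun x => ?_)
    exact integral_congr_ae (ae_restrict_of_ae (huU x))

/-! ### Hilbert-Schmidt norm of an operator with a Weyl-type kernel -/

section WeylKernel

variable {E : Type*} [NormedAddCommGroup E] [InnerProductSpace ℝ E] [FiniteDimensional ℝ E]
  [MeasurableSpace E] [BorelSpace E]

/-- Parseval for the function `K` of `y = ξ - r p`. -/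
theorem tsum_enorm_integral_reflect_sq {ι : Type*}
    (b : HilbertBasis ι ℂ (Lp ℂ 2 (volume : Measure E))) {F : E → ℂ} (hF : MemLp F 2)
    {r : ℝ} (hr : 0 < r) (ξ : E) :
    ENNReal.ofReal (r ^ Module.finrank ℝ E) * ∑' i, ‖∫ p, F p * b i (ξ - r • p)‖ₑ ^ 2
      = ∫⁻ p, ‖F p‖ₑ ^ 2 := by
  have hr0 : r ≠ 0 := hr.ne'
  set c : ℝ := r ^ Module.finrank ℝ E with hc
  have hc0 : 0 < c := by positivity
  set K : E → ℂ := fun y => F (r⁻¹ • (ξ - y)) with hKdef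
  have e1 : ∀ i, ∫ y, K y * b i y = (c : ℂ) * ∫ p, F p * b i (ξ - r • p) := by
    intro i
    rw [← integral_sub_left_eq_self (fun y => K y * b i y) volume ξ, integral_smul_eq _ hr]
    simp [K, hr0, hc]
  have e2 : ∫⁻ y, ‖K y‖ₑ ^ 2 = ENNReal.ofReal c * ∫⁻ p, ‖F p‖ₑ ^ 2 := by
    rw [← lintegral_sub_left_eq_self (fun y => ‖K y‖ₑ ^ 2) ξ, lintegral_smul_eq _ hr]
    simp [K, hr0, hc]
  have hqmp : Measure.QuasiMeasurePreserving (fun y : E => r⁻¹ • (ξ - y)) volume volume := by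
    have h1 : Measure.QuasiMeasurePreserving (fun y : E => r⁻¹ • y) volume volume := by
      refine ⟨by fun_prop, ?_⟩
      rw [Measure.map_addHaar_smul (volume : Measure E) (inv_ne_zero hr0)]
      exact Measure.smul_absolutelyContinuous
    exact h1.comp (Measure.measurePreserving_sub_left volume ξ).quasiMeasurePreserving
  have hKm : AEStronglyMeasurable K := hF.1.comp_quasiMeasurePreserving hqmp
  have hK : MemLp K 2 := by
    refine memLp_two_iff.2 ⟨hKm, ?_⟩
    rw [e2]
    exact ENNReal.mul_lt_top ENNReal.ofReal_lt_top (memLp_two_iff.1 hF).2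
  have h := tsum_enorm_integral_sq b hK
  simp only [e1, enorm_mul, mul_pow] at h
  rw [ENNReal.tsum_mul_left, e2] at h
  have hce : ‖(c : ℂ)‖ₑ = ENNReal.ofReal c := by
    rw [← ofReal_norm, Complex.norm_real, Real.norm_of_nonneg hc0.le]
  -- The Jacobian `c` appears squared on the left, where it is inside the squared integrals, and
  -- once on the right; one factor cancels.
  rw [hce, sq, mul_assoc] at h
  exact (ENNReal.mul_right_inj (by simpa using hc0) ENNReal.ofReal_ne_top).1 h

theorem stronglyMeasurable_angularFourier {X : Type*} [MeasurableSpace X] {g : X × E → ℂ}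
    (hg : Measurable g) :
    StronglyMeasurable fun y : X × E => angularFourier (fun q => g (y.1, q)) y.2 := by
  unfold angularFourier
  refine StronglyMeasurable.integral_prod_right
    (f := fun (y : X × E) (q : E) => g (y.1, q) * Complex.exp (-(Complex.I * (inner ℝ q y.2 : ℝ)))) ?_
  refine Measurable.stronglyMeasurable ?_
  refine Measurable.mul (hg.comp (by fun_prop)) ?_
  have : Continuous fun y : E × E => Complex.exp (-(Complex.I * (inner ℝ y.2 y.1 : ℝ))) := by
    fun_prop
  exact this.measurable.comp (g := fun y : E × E => Complex.exp (-(Complex.I * (inner ℝ y.2 y.1 : ℝ))))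
    (f := fun y : (X × E) × E => (y.1.2, y.2)) (by fun_prop)

theorem ae_memLp_prod_right {X Y : Type*} [MeasurableSpace X] [MeasurableSpace Y] {μ : Measure X}
    {ν : Measure Y} [SFinite ν] {g : X × Y → ℂ} (hg : Measurable g) (h : MemLp g 2 (μ.prod ν)) :
    ∀ᵐ x ∂μ, MemLp (fun y => g (x, y)) 2 ν := by
  have h2 := (memLp_two_iff.1 h).2
  have hm : Measurable fun y : X × Y => ‖g y‖ₑ ^ 2 := hg.enorm.pow_const 2
  rw [lintegral_prod _ hm.aemeasurable] at h2
  filter_upwards [ae_lt_top hm.lintegral_prod_right' h2.ne] with x hx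
  exact memLp_two_iff.2 ⟨(hg.comp measurable_prodMk_left).aestronglyMeasurable, hx⟩

theorem lintegral_angularFourier_prod {X : Type*} [MeasurableSpace X] {μ : Measure X} [SFinite μ]
    {g : X × E → ℂ} (hg : Measurable g)
    (h1 : ∀ᵐ x ∂μ, Integrable fun y => g (x, y)) (h2 : MemLp g 2 (μ.prod volume)) :
    ∫⁻ x, (∫⁻ s, ‖angularFourier (fun q => g (x, q)) s‖ₑ ^ 2) ∂μ
      = ENNReal.ofReal ((2 * Real.pi) ^ Module.finrank ℝ E)
        * ∫⁻ y, ‖g y‖ₑ ^ 2 ∂(μ.prod volume) := by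
  rw [lintegral_prod _ (hg.enorm.pow_const 2).aemeasurable,
    ← lintegral_const_mul' _ _ ENNReal.ofReal_ne_top]
  refine lintegral_congr_ae ?_
  filter_upwards [h1, ae_memLp_prod_right hg h2] with x p1 p2
  exact lintegral_angularFourier p1 p2

/-- For almost every fixed `ξ`, Parseval in `p` removes the basis at the cost of one Jacobian `r ^
n`, where `n` is the dimension. The other one comes from `ξ ↦ r • ξ`. The shift by `t • p`
disappears by translation invariance once `ξ` is integrated at fixed `p`, and Plancherel in `q` ends
the computation. -/
theorem tsum_lintegral_weyl_sq {ι : Type*} [Countable ι]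
    (b : HilbertBasis ι ℂ (Lp ℂ 2 (volume : Measure E))) {g : E × E → ℂ} (hg : Measurable g)
    (h1 : Integrable g) (h2 : MemLp g 2) {r : ℝ} (hr : 0 < r) (t : ℝ) :
    ENNReal.ofReal (r ^ Module.finrank ℝ E * r ^ Module.finrank ℝ E) * ∑' i, ∫⁻ ξ,
        ‖∫ p, angularFourier (fun q => g (p, q)) (r • ξ - t • p) * b i (ξ - r • p)‖ₑ ^ 2
      = ENNReal.ofReal ((2 * Real.pi) ^ Module.finrank ℝ E) * ∫⁻ x, ‖g x‖ₑ ^ 2 := by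
  set G : E × E → ℂ := fun y => angularFourier (fun q => g (y.1, q)) y.2 with hG
  have hGm : Measurable G := (stronglyMeasurable_angularFourier hg).measurable
  have hbm : ∀ i, Measurable (b i : E → ℂ) := fun i => (Lp.stronglyMeasurable (b i)).measurable
  set c := ENNReal.ofReal (r ^ Module.finrank ℝ E) with hc
  have hsub : ∀ p, c * ∫⁻ ξ, ‖G (p, r • ξ - t • p)‖ₑ ^ 2 = ∫⁻ s, ‖G (p, s)‖ₑ ^ 2 := by
    intro p
    rw [← lintegral_sub_right_eq_self (fun s => ‖G (p, s)‖ₑ ^ 2) (t • p),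
      lintegral_smul_eq (fun s => ‖G (p, s - t • p)‖ₑ ^ 2) hr]
  have htot : c * ∫⁻ ξ, ∫⁻ p, ‖G (p, r • ξ - t • p)‖ₑ ^ 2
      = ENNReal.ofReal ((2 * Real.pi) ^ Module.finrank ℝ E) * ∫⁻ x, ‖g x‖ₑ ^ 2 := by
    rw [lintegral_lintegral_swap (by fun_prop), ← lintegral_const_mul' _ _ ENNReal.ofReal_ne_top]
    refine (lintegral_congr hsub).trans ?_
    exact lintegral_angularFourier_prod hg h1.prod_right_ae h2
  -- Parseval needs a kernel in `L²`; finiteness of the total integral gives this for almost every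
  -- `ξ`.
  have hfin : ∫⁻ ξ, ∫⁻ p, ‖G (p, r • ξ - t • p)‖ₑ ^ 2 ≠ ⊤ := by
    intro h
    rw [h, ENNReal.mul_top (by simp [hc]; positivity)] at htot
    exact (ENNReal.mul_lt_top ENNReal.ofReal_lt_top (memLp_two_iff.1 h2).2).ne htot.symm
  have hmem : ∀ᵐ ξ, MemLp (fun p => G (p, r • ξ - t • p)) 2 := by
    filter_upwards [ae_lt_top (Measurable.lintegral_prod_right' (f := fun y : E × E =>
      ‖G (y.2, r • y.1 - t • y.2)‖ₑ ^ 2) (by fun_prop)) hfin] with ξ hξ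
    exact memLp_two_iff.2 ⟨(hGm.comp (by fun_prop)).aestronglyMeasurable, hξ⟩
  have hm : ∀ i, Measurable fun ξ =>
      ‖∫ p, G (p, r • ξ - t • p) * b i (ξ - r • p)‖ₑ ^ 2 := by
    intro i
    refine (Measurable.enorm ?_).pow_const 2
    refine (StronglyMeasurable.integral_prod_right (f := fun (ξ p : E) =>
      G (p, r • ξ - t • p) * b i (ξ - r • p)) (Measurable.stronglyMeasurable ?_)).measurable
    have := hbm i
    change Measurable fun y : E × E => G (y.2, r • y.1 - t • y.2) * b i (y.1 - r • y.2)
    fun_prop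
  rw [ENNReal.ofReal_mul (by positivity), ← htot, mul_assoc]
  congr 1
  rw [← lintegral_tsum fun i => (hm i).aemeasurable,
    ← lintegral_const_mul' _ _ ENNReal.ofReal_ne_top]
  refine lintegral_congr_ae ?_
  filter_upwards [hmem] with ξ hξ
  exact tsum_enorm_integral_reflect_sq b hξ hr ξ

end WeylKernel

/-! ### Uniform decay of Schwartz functions -/

section SchwartzBounds

variable {D : Type*} [NormedAddCommGroup D] [NormedSpace ℝ D]

/-- A continuous seminorm on Schwartz space that controls the decay of order `k`. -/
def decaySeminorm (k : ℕ) (f : 𝓢(D, ℂ)) : ℝ :=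
  2 ^ k * ((Finset.Iic (k, 0)).sup fun m => SchwartzMap.seminorm ℝ m.1 m.2) f

theorem norm_le_decaySeminorm (k : ℕ) (f : 𝓢(D, ℂ)) (x : D) :
    ‖f x‖ ≤ decaySeminorm k f * (1 + ‖x‖) ^ (-(k : ℝ)) := by
  have h := SchwartzMap.one_add_le_sup_seminorm_apply (𝕜 := ℝ) (m := (k, 0)) le_rfl le_rfl f x
  rw [norm_iteratedFDeriv_zero] at h
  rw [Real.rpow_neg (by positivity), Real.rpow_natCast, ← div_eq_mul_inv, le_div_iff₀
    (by positivity), mul_comm]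
  exact h

theorem decaySeminorm_nonneg (k : ℕ) (f : 𝓢(D, ℂ)) : 0 ≤ decaySeminorm k f :=
  mul_nonneg (by positivity) (apply_nonneg _ _)

theorem continuous_decaySeminorm (k : ℕ) : Continuous (decaySeminorm k : 𝓢(D, ℂ) → ℝ) := by
  refine continuous_const.mul ?_
  refine (NNReal.continuous_coe.comp (Continuous.finset_sup_apply
    (L := NNReal) (s := Finset.Iic (k, (0 : ℕ))) (f := (fun m f =>
      ⟨SchwartzMap.seminorm ℝ m.1 m.2 f, apply_nonneg _ _⟩ : ℕ × ℕ → 𝓢(D, ℂ) → NNReal))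
    fun m _ => ?_)).congr fun f => (Seminorm.finset_sup_apply _ _ f).symm
  exact ((schwartz_withSeminorms ℝ D ℂ).continuous_seminorm m).subtype_mk _

end SchwartzBounds

/-! ### Partial Fourier transform in the center -/

variable {V Z : Type*} [NormedAddCommGroup V] [InnerProductSpace ℝ V]
  [NormedAddCommGroup Z] [InnerProductSpace ℝ Z] {A : LieStructure V Z} {d : ℕ}
  [FiniteDimensional ℝ V] [FiniteDimensional ℝ Z]
  [MeasurableSpace V] [BorelSpace V] [MeasurableSpace Z] [BorelSpace Z]

/-- The partial Fourier transform `∫ f(v, z) exp (-i lam z) dz` in the central variable. -/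
def centralFourier (f : Group V Z → ℂ) (lam : Z →L[ℝ] ℝ) (v : V) : ℂ :=
  ∫ z, f (v, z) * Complex.exp (-(Complex.I * (lam z : ℝ)))

theorem norm_exp_neg_I_mul (t : ℝ) : ‖Complex.exp (-(Complex.I * (t : ℂ)))‖ = 1 := by
  rw [show -(Complex.I * (t : ℂ)) = ((-t : ℝ) : ℂ) * Complex.I by push_cast; ring]
  exact Complex.norm_exp_ofReal_mul_I _

theorem integrable_centralKernel (f : 𝓢(Group V Z, ℂ)) (lam : Z →L[ℝ] ℝ) :
    Integrable fun x : Group V Z => f x * Complex.exp (-(Complex.I * (lam x.2 : ℝ))) := by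
  refine Integrable.mono' f.integrable.norm ?_ (Eventually.of_forall fun x => ?_)
  · exact (f.continuous.mul (by fun_prop)).aestronglyMeasurable
  · rw [norm_mul, norm_exp_neg_I_mul, mul_one]

theorem stronglyMeasurable_centralFourier (f : 𝓢(Group V Z, ℂ)) (lam : Z →L[ℝ] ℝ) :
    StronglyMeasurable (centralFourier f lam) := by
  unfold centralFourier
  refine StronglyMeasurable.integral_prod_right
    (f := fun v z => f (v, z) * Complex.exp (-(Complex.I * (lam z : ℝ)))) ?_
  have : Continuous fun x : V × Z => f x * Complex.exp (-(Complex.I * (lam x.2 : ℝ))) :=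
    f.continuous.mul (by fun_prop)
  exact this.stronglyMeasurable

theorem integrable_centralFourier (f : 𝓢(Group V Z, ℂ)) (lam : Z →L[ℝ] ℝ) :
    Integrable (centralFourier f lam) :=
  (integrable_centralKernel f lam).integral_prod_left

theorem exists_norm_centralFourier_le (f : 𝓢(Group V Z, ℂ)) :
    ∃ C, ∀ lam v, ‖centralFourier f lam v‖ ≤ C := by
  set k := Module.finrank ℝ Z + 1 with hk
  refine ⟨∫ z : Z, decaySeminorm k f * (1 + ‖z‖) ^ (-(k : ℝ)), fun lam v => ?_⟩
  refine norm_integral_le_of_norm_le ?_ (Eventually.of_forall fun z => ?_)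
  · refine (integrable_one_add_norm ?_).const_mul _
    rw [hk]; push_cast; linarith
  · rw [norm_mul, norm_exp_neg_I_mul, mul_one]
    refine (norm_le_decaySeminorm k f _).trans ?_
    refine mul_le_mul_of_nonneg_left ?_ (decaySeminorm_nonneg _ _)
    refine Real.rpow_le_rpow_of_nonpos (by positivity) ?_ (by simp)
    simp

/-- A bounded integrable function is square integrable. -/
theorem memLp_centralFourier (f : 𝓢(Group V Z, ℂ)) (lam : Z →L[ℝ] ℝ) :
    MemLp (centralFourier f lam) 2 := by
  obtain ⟨C, hC⟩ := exists_norm_centralFourier_le f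
  have hm := (stronglyMeasurable_centralFourier f lam).aestronglyMeasurable (μ := volume)
  rw [memLp_two_iff_integrable_sq_norm hm]
  refine Integrable.mono' ((integrable_centralFourier f lam).norm.const_mul C)
    (hm.norm.pow 2) (Eventually.of_forall fun v => ?_)
  rw [Real.norm_of_nonneg (by positivity), sq]
  exact mul_le_mul_of_nonneg_right (hC lam v) (norm_nonneg _)

/-- The coordinates `(p, q)` on `V`. -/
def Frame.coords (e : Frame A d) (lam : Z →L[ℝ] ℝ) : V ≃ᵐ Eucl d × Eucl d :=
  (e.basis lam).measurableEquiv.trans <| (MeasurableEquiv.toLp 2 (Fin d ⊕ Fin d → ℝ)).symm.trans <|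
    (MeasurableEquiv.sumPiEquivProdPi fun _ => ℝ).trans <|
      (MeasurableEquiv.toLp 2 (Fin d → ℝ)).prodCongr (MeasurableEquiv.toLp 2 (Fin d → ℝ))

theorem Frame.coords_apply (e : Frame A d) (lam : Z →L[ℝ] ℝ) (v : V) :
    e.coords lam v = (e.p lam v, e.q lam v) := rfl

theorem Frame.measurePreserving_coords (e : Frame A d) (lam : Z →L[ℝ] ℝ) :
    MeasurePreserving (e.coords lam) := by
  have h1 := (e.basis lam).measurePreserving_measurableEquiv
  have h2 := EuclideanSpace.volume_preserving_symm_measurableEquiv_toLp (Fin d ⊕ Fin d)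
  have h3 := volume_measurePreserving_sumPiEquivProdPi (fun _ : Fin d ⊕ Fin d => ℝ)
  have h4 := (EuclideanSpace.volume_preserving_symm_measurableEquiv_toLp (Fin d)).symm
  exact (h4.prod h4).comp (h3.comp (h2.comp h1))

/-! ### The group Fourier transform as an integral operator -/

theorem Frame.rep_symm_ae (e : Frame A d) (lam : Z →L[ℝ] ℝ) (x : Group V Z) (Φ : L2 d) :
    (e.rep lam x).symm Φ =ᵐ[volume] fun ξ =>
      Complex.exp (-(Complex.I * (e.phase lam x (ξ - √‖lam‖ • e.p lam x.1) : ℝ)))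
        * Φ (ξ - √‖lam‖ • e.p lam x.1) := by
  set a := √‖lam‖ • e.p lam x.1 with ha
  have h1 := Lp.coeFn_compMeasurePreserving (p := 2)
    ((phase_memLp (-(e.phase lam x)) Φ).toLp) (measurePreserving_add_right volume (-a))
  have h2 := (measurePreserving_add_right volume (-a)).quasiMeasurePreserving.ae_eq
    (phase_memLp (-(e.phase lam x)) Φ).coeFn_toLp
  have h0 : (e.rep lam x).symm Φ = Lp.compMeasurePreserving (fun ξ : Eucl d => ξ + -a)
    (measurePreserving_add_right volume (-a)) ((phase_memLp (-(e.phase lam x)) Φ).toLp) := rfl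
  rw [h0]
  filter_upwards [h1, h2] with ξ h1 h2
  rw [h1, Function.comp_apply]
  refine h2.trans ?_
  simp [sub_eq_add_neg]

/-- The `½ |lam| p·q` of the representation and the `-|lam| p·q` due to the translation add up to
`-½ |lam| p·q`. The phase is then linear in `q`, so integrating over `q` produces a Fourier
transform. -/
theorem Frame.phase_sub (e : Frame A d) (lam : Z →L[ℝ] ℝ) (x : Group V Z) (ξ : Eucl d) :
    e.phase lam x (ξ - √‖lam‖ • e.p lam x.1) = lam x.2
      + inner ℝ (e.q lam x.1) (√‖lam‖ • ξ - (‖lam‖ / 2) • e.p lam x.1) := by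
  change lam x.2 + 1 / 2 * ‖lam‖ * inner ℝ (e.p lam x.1) (e.q lam x.1)
    + √‖lam‖ * inner ℝ (ξ - √‖lam‖ • e.p lam x.1) (e.q lam x.1) = _
  have h := Real.mul_self_sqrt (norm_nonneg lam)
  rw [real_inner_comm (e.q lam x.1) (ξ - _)]
  simp only [inner_sub_right, inner_smul_right, real_inner_comm (e.q lam x.1) (e.p lam x.1)]
  linear_combination (-inner ℝ (e.q lam x.1) (e.p lam x.1)) * h

theorem Frame.fourier_apply_ae (e : Frame A d) (lam : Z →L[ℝ] ℝ) (f : 𝓢(Group V Z, ℂ))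
    (Φ : L2 d) :
    e.fourier f lam Φ =ᵐ[volume] fun ξ => ∫ p,
      angularFourier (fun q => centralFourier f lam ((e.coords lam).symm (p, q)))
        (√‖lam‖ • ξ - (‖lam‖ / 2) • p) * Φ (ξ - √‖lam‖ • p) := by
  have hp : Continuous fun x : Group V Z => e.p lam x.1 := by
    unfold Frame.p; fun_prop
  have hq : Continuous fun x : Group V Z => e.q lam x.1 := by
    unfold Frame.q; fun_prop
  have hΦ : Measurable (Φ : Eucl d → ℂ) := (Lp.stronglyMeasurable Φ).measurable
  set U : Group V Z → Eucl d → ℂ := fun x ξ => f x *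
    (Complex.exp (-(Complex.I * (lam x.2
      + inner ℝ (e.q lam x.1) (√‖lam‖ • ξ - (‖lam‖ / 2) • e.p lam x.1) : ℝ)))
        * Φ (ξ - √‖lam‖ • e.p lam x.1)) with hU
  have hUm : Measurable (Function.uncurry U) := by
    have h1 : Continuous fun y : Group V Z × Eucl d => e.p lam y.1.1 := hp.comp continuous_fst
    have h2 : Continuous fun y : Group V Z × Eucl d => e.q lam y.1.1 := hq.comp continuous_fst
    have h3 : Continuous fun y : Group V Z × Eucl d => f y.1 := f.continuous.comp continuous_fst
    have h4 : Continuous fun y : Group V Z × Eucl d => Complex.exp (-(Complex.I * (lam y.1.2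
      + inner ℝ (e.q lam y.1.1) (√‖lam‖ • y.2 - (‖lam‖ / 2) • e.p lam y.1.1) : ℝ))) := by
      fun_prop
    have h5 : Continuous fun y : Group V Z × Eucl d => y.2 - √‖lam‖ • e.p lam y.1.1 := by
      fun_prop
    exact h3.measurable.mul (h4.measurable.mul (hΦ.comp h5.measurable))
  have hae := coeFn_integral_ae_eq (e.integrable_rep_symm lam f Φ) (U := U)
    hUm.aestronglyMeasurable (fun x => by
      filter_upwards [Lp.coeFn_smul (f x) ((e.rep lam x).symm Φ), e.rep_symm_ae lam x Φ]
        with ξ h1 h2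
      rw [h1, Pi.smul_apply, h2, e.phase_sub, smul_eq_mul])
  have hF : e.fourier f lam Φ = ∫ x : Group V Z, f x • (e.rep lam x).symm Φ := rfl
  rw [hF]
  filter_upwards [hae.1, hae.2] with ξ hint heq
  rw [heq]
  -- Integrating over `z` first leaves a function of `v` alone, which is `W` in the coordinates `(p,
  -- q)`.
  set W : Eucl d × Eucl d → ℂ := fun y => centralFourier f lam ((e.coords lam).symm y) *
    Complex.exp (-(Complex.I * (inner ℝ y.2 (√‖lam‖ • ξ - (‖lam‖ / 2) • y.1) : ℝ)))
        * Φ (ξ - √‖lam‖ • y.1) with hW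
  have hVW : (fun v => ∫ z, U (v, z) ξ) = fun v => W (e.coords lam v) := by
    funext v
    simp only [hU, hW, MeasurableEquiv.symm_apply_apply, centralFourier]
    rw [← integral_mul_const, ← integral_mul_const]
    refine integral_congr_ae (Eventually.of_forall fun z => ?_)
    simp only [e.coords_apply]
    push_cast
    rw [mul_add, neg_add, Complex.exp_add]
    ring
  have hWint : Integrable W := by
    rw [← (e.measurePreserving_coords lam).integrable_comp_emb (e.coords lam).measurableEmbedding]
    have := hint.integral_prod_left
    rwa [hVW] at this
  have h1 : ∫ x, U x ξ = ∫ v, ∫ z, U (v, z) ξ := integral_prod _ hint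
  rw [h1, hVW, (e.measurePreserving_coords lam).integral_comp (e.coords lam).measurableEmbedding,
    Measure.volume_eq_prod, integral_prod _ hWint]
  refine integral_congr_ae (Eventually.of_forall fun p => ?_)
  simp only [hW, angularFourier]
  rw [← integral_mul_const]

/-- This is `tsum_lintegral_weyl_sq` with `r = √|lam|` and `t = |lam| / 2`; the two Jacobians
combine to `|lam| ^ d`. -/
theorem Frame.tsum_enorm_fourier_sq (e : Frame A d) {lam : Z →L[ℝ] ℝ} (hlam : lam ≠ 0)
    (f : 𝓢(Group V Z, ℂ)) {ι : Type*} (b : HilbertBasis ι ℂ (L2 d)) :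
    ENNReal.ofReal (‖lam‖ ^ d) * ∑' i, ‖e.fourier f lam (b i)‖ₑ ^ 2
      = ENNReal.ofReal ((2 * Real.pi) ^ d) * ∫⁻ v, ‖centralFourier f lam v‖ₑ ^ 2 := by
  have : Fact ((2 : ENNReal) ≠ ⊤) := ⟨by norm_num⟩
  have : Countable ι := countable_of_hilbertBasis b
  have hr : 0 < √‖lam‖ := Real.sqrt_pos.2 (norm_pos_iff.2 hlam)
  have hmp := (e.measurePreserving_coords lam).symm
  have hw := tsum_lintegral_weyl_sq b
    (g := fun y => centralFourier f lam ((e.coords lam).symm y))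
    ((stronglyMeasurable_centralFourier f lam).measurable.comp (e.coords lam).symm.measurable)
    (hmp.integrable_comp_of_integrable (integrable_centralFourier f lam))
    ((memLp_centralFourier f lam).comp_measurePreserving hmp) hr (‖lam‖ / 2)
  rw [hmp.lintegral_comp_emb (e.coords lam).symm.measurableEmbedding
    (fun v => ‖centralFourier f lam v‖ₑ ^ 2), ← mul_pow, Real.mul_self_sqrt (norm_nonneg _),
    finrank_euclideanSpace_fin] at hw
  rw [← hw]
  congr 2
  funext i
  rw [Lp.enorm_def, eLpNorm_congr_ae (e.fourier_apply_ae lam f (b i)),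
    lintegral_enorm_sq]

/-! ### Polarization of the Plancherel formula at fixed `lam` -/

theorem inner_eq_sum_norm_add_smul_sq {G : Type*} [NormedAddCommGroup G] [InnerProductSpace ℂ G]
    (p q : G) :
    inner ℂ p q = ((‖p + (1 : ℂ) • q‖ : ℂ) ^ 2 - (‖p + (-1 : ℂ) • q‖ : ℂ) ^ 2
      + ((‖p + (-Complex.I) • q‖ : ℂ) ^ 2 - (‖p + Complex.I • q‖ : ℂ) ^ 2) * Complex.I) / 4 := by
  rw [inner_eq_sum_norm_sq_div_four]
  simp [sub_eq_add_neg]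

/-- Polarization with `a = ±1, ±i`. Summability of the inner products follows from that of the four
series of squares. -/
theorem hasSum_inner_of_hasSum_norm_sq {H K ι : Type*} [NormedAddCommGroup H]
    [InnerProductSpace ℂ H] [NormedAddCommGroup K] [InnerProductSpace ℂ K] {x y : ι → H} {u w : K}
    {c : ℝ} (h : ∀ a : ℂ, HasSum (fun i => ‖x i + a • y i‖ ^ 2) (c * ‖u + a • w‖ ^ 2)) :
    HasSum (fun i => inner ℂ (x i) (y i)) (c * inner ℂ u w) := by
  have h' : ∀ a : ℂ, HasSum (fun i => (‖x i + a • y i‖ : ℂ) ^ 2) (c * (‖u + a • w‖ : ℂ) ^ 2) := by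
    intro a
    exact_mod_cast Complex.hasSum_ofReal.2 (h a)
  have h1 := (((h' 1).sub (h' (-1))).add
    (((h' (-Complex.I)).sub (h' Complex.I)).mul_right Complex.I)).div_const 4
  simp only [inner_eq_sum_norm_add_smul_sq]
  refine Eq.subst (motive := fun t => HasSum _ t) ?_ h1
  ring

theorem Frame.fourier_add_smul (e : Frame A d) (lam : Z →L[ℝ] ℝ) (h f : 𝓢(Group V Z, ℂ)) (a : ℂ)
    (Φ : L2 d) : e.fourier (h + a • f) lam Φ = e.fourier h lam Φ + a • e.fourier f lam Φ := by
  change ∫ x : Group V Z, (h + a • f) x • (e.rep lam x).symm Φ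
    = (∫ x : Group V Z, h x • (e.rep lam x).symm Φ) + a • ∫ x : Group V Z, f x • (e.rep lam x).symm Φ
  have h2 := integral_add (e.integrable_rep_symm lam h Φ) ((e.integrable_rep_symm lam f Φ).smul a)
  simp only [Pi.smul_apply] at h2
  rw [← integral_smul, ← h2]
  refine integral_congr_ae (Eventually.of_forall fun x => ?_)
  simp [add_smul, mul_smul]

theorem integrable_slice (f : 𝓢(Group V Z, ℂ)) (v : V) : Integrable fun z => f (v, z) := by
  set k := Module.finrank ℝ Z + 1 with hk
  refine Integrable.mono' (g := fun z => decaySeminorm k f * (1 + ‖z‖) ^ (-(k : ℝ))) ?_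
    (f.continuous.comp (by fun_prop)).aestronglyMeasurable (Eventually.of_forall fun z => ?_)
  · refine (integrable_one_add_norm ?_).const_mul _
    rw [hk]; push_cast; linarith
  · refine (norm_le_decaySeminorm k f _).trans ?_
    refine mul_le_mul_of_nonneg_left ?_ (decaySeminorm_nonneg _ _)
    refine Real.rpow_le_rpow_of_nonpos (by positivity) ?_ (by simp)
    simp

theorem centralFourier_add_smul (lam : Z →L[ℝ] ℝ) (h f : 𝓢(Group V Z, ℂ)) (a : ℂ) (v : V) :
    centralFourier (h + a • f) lam v = centralFourier h lam v + a * centralFourier f lam v := by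
  have hi : ∀ g : 𝓢(Group V Z, ℂ),
      Integrable fun z => g (v, z) * Complex.exp (-(Complex.I * (lam z : ℝ))) := by
    intro g
    refine Integrable.mono' (integrable_slice g v).norm ?_ (Eventually.of_forall fun x => ?_)
    · exact ((g.continuous.comp (by fun_prop)).mul (by fun_prop)).aestronglyMeasurable
    · rw [norm_mul, norm_exp_neg_I_mul, mul_one]
  unfold centralFourier
  rw [← integral_const_mul, ← integral_add (hi h) ((hi f).const_mul a)]
  refine integral_congr_ae (Eventually.of_forall fun z => ?_)
  change (h (v, z) + a * f (v, z)) * _ = _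
  ring

/-- The partial Fourier transform as an element of `L²(V)`. -/
def centralLp (lam : Z →L[ℝ] ℝ) (f : 𝓢(Group V Z, ℂ)) : Lp ℂ 2 (volume : Measure V) :=
  (memLp_centralFourier f lam).toLp

theorem centralLp_add_smul (lam : Z →L[ℝ] ℝ) (h f : 𝓢(Group V Z, ℂ)) (a : ℂ) :
    centralLp lam (h + a • f) = centralLp lam h + a • centralLp lam f := by
  apply Lp.ext
  filter_upwards [(memLp_centralFourier (h + a • f) lam).coeFn_toLp,
    (memLp_centralFourier h lam).coeFn_toLp, (memLp_centralFourier f lam).coeFn_toLp,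
    Lp.coeFn_add (centralLp lam h) (a • centralLp lam f), Lp.coeFn_smul a (centralLp lam f)]
    with v h1 h2 h3 h4 h5
  rw [h4, Pi.add_apply, h5, Pi.smul_apply]
  unfold centralLp
  rw [h1, h2, h3, smul_eq_mul, ← centralFourier_add_smul]

theorem inner_centralLp (lam : Z →L[ℝ] ℝ) (h f : 𝓢(Group V Z, ℂ)) :
    inner ℂ (centralLp lam h) (centralLp lam f)
      = ∫ v, starRingEnd ℂ (centralFourier h lam v) * centralFourier f lam v := by
  rw [L2.inner_def]
  refine integral_congr_ae ?_
  filter_upwards [(memLp_centralFourier h lam).coeFn_toLp,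
    (memLp_centralFourier f lam).coeFn_toLp] with v h2 h3
  unfold centralLp
  rw [h2, h3, RCLike.inner_apply, mul_comm]

theorem Frame.hasSum_norm_fourier_sq (e : Frame A d) {lam : Z →L[ℝ] ℝ} (hlam : lam ≠ 0)
    (f : 𝓢(Group V Z, ℂ)) {ι : Type*} (b : HilbertBasis ι ℂ (L2 d)) :
    HasSum (fun i => ‖e.fourier f lam (b i)‖ ^ 2)
      ((‖lam‖ ^ d)⁻¹ * (2 * Real.pi) ^ d * ‖centralLp lam f‖ ^ 2) := by
  have hl : 0 < ‖lam‖ := norm_pos_iff.2 hlam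
  have h := e.tsum_enorm_fourier_sq hlam f b
  have h1 : ∫⁻ v, ‖centralFourier f lam v‖ₑ ^ 2 = ENNReal.ofReal (‖centralLp lam f‖ ^ 2) :=
    MemLp.lintegral_enorm_sq_eq _
  have h2 : ∑' i, ENNReal.ofReal (‖e.fourier f lam (b i)‖ ^ 2)
      = ENNReal.ofReal ((‖lam‖ ^ d)⁻¹ * (2 * Real.pi) ^ d * ‖centralLp lam f‖ ^ 2) := by
    simp only [ENNReal.ofReal_pow (norm_nonneg _), ofReal_norm]
    rw [h1, ← ENNReal.ofReal_mul (by positivity)] at h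
    rw [← ENNReal.mul_right_inj (a := ENNReal.ofReal (‖lam‖ ^ d)) (by
      rw [Ne, ENNReal.ofReal_eq_zero, not_le]; positivity)
      ENNReal.ofReal_ne_top, h, ← ENNReal.ofReal_mul (by positivity)]
    congr 1
    field_simp
  have hs : Summable fun i => ‖e.fourier f lam (b i)‖ ^ 2 := by
    have := ENNReal.summable_toReal (h2.trans_ne ENNReal.ofReal_ne_top)
    simpa [ENNReal.toReal_ofReal, sq_nonneg] using this
  rw [← ENNReal.ofReal_tsum_of_nonneg (fun i => sq_nonneg _) hs,
    ENNReal.ofReal_eq_ofReal_iff (tsum_nonneg fun i => sq_nonneg _) (by positivity)] at h2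
  rw [← h2]
  exact hs.hasSum

theorem Frame.hasSum_inner_fourier (e : Frame A d) {lam : Z →L[ℝ] ℝ} (hlam : lam ≠ 0)
    (h f : 𝓢(Group V Z, ℂ)) {ι : Type*} (b : HilbertBasis ι ℂ (L2 d)) :
    HasSum (fun i => inner ℂ (e.fourier h lam (b i)) (e.fourier f lam (b i)))
      (((‖lam‖ ^ d)⁻¹ * (2 * Real.pi) ^ d : ℝ)
        * ∫ v, starRingEnd ℂ (centralFourier h lam v) * centralFourier f lam v) := by
  rw [← inner_centralLp]
  refine hasSum_inner_of_hasSum_norm_sq fun a => ?_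
  simp only [← e.fourier_add_smul, ← centralLp_add_smul]
  exact e.hasSum_norm_fourier_sq hlam _ b

theorem Frame.isHilbertSchmidt_fourier (e : Frame A d) {lam : Z →L[ℝ] ℝ} (hlam : lam ≠ 0)
    (f : 𝓢(Group V Z, ℂ)) : IsHilbertSchmidt (e.fourier f lam) :=
  fun _ b => (e.hasSum_norm_fourier_sq hlam f b).summable

/-! ### The integral over the dual of the center -/

theorem centralFourier_innerSL (f : Group V Z → ℂ) (ζ : Z) (v : V) :
    centralFourier f (innerSL ℝ ζ) v = angularFourier (fun z => f (v, z)) ζ := by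
  simp only [centralFourier, angularFourier, innerSL_apply_apply, real_inner_comm]

theorem memLp_angularFourier_slice (f : 𝓢(Group V Z, ℂ)) :
    MemLp (fun y : V × Z => angularFourier (fun z => f (y.1, z)) y.2) 2
      ((volume : Measure V).prod volume) := by
  have hf : Measurable (f : V × Z → ℂ) := f.continuous.measurable
  have hm := stronglyMeasurable_angularFourier hf
  have hf2 : MemLp f 2 ((volume : Measure V).prod (volume : Measure Z)) := f.memLp 2 volume
  refine memLp_two_iff.2 ⟨hm.aestronglyMeasurable, ?_⟩
  rw [lintegral_prod _ (hm.measurable.enorm.pow_const 2).aemeasurable,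
    lintegral_angularFourier_prod hf (Eventually.of_forall (integrable_slice f)) hf2]
  exact ENNReal.mul_lt_top ENNReal.ofReal_lt_top (memLp_two_iff.1 hf2).2

theorem integrable_prod_angularFourier (h f : 𝓢(Group V Z, ℂ)) :
    Integrable (fun y : V × Z => starRingEnd ℂ (angularFourier (fun z => h (y.1, z)) y.2)
      * angularFourier (fun z => f (y.1, z)) y.2) ((volume : Measure V).prod volume) :=
  (memLp_angularFourier_slice h).star.integrable_mul (memLp_angularFourier_slice f)

theorem measurableEmbedding_innerSL : MeasurableEmbedding fun z : Z => innerSL ℝ z :=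
  (InnerProductSpace.toDual ℝ Z).toHomeomorph.measurableEmbedding

/-- The source of absolute convergence: by Plancherel in `z` both transforms are in `L²(V × Z)`, so
their product is integrable, and Fubini applies. -/
theorem integrable_inner_centralFourier (h f : 𝓢(Group V Z, ℂ)) :
    Integrable (fun lam => ∫ v, starRingEnd ℂ (centralFourier h lam v) * centralFourier f lam v)
      (dualVolume Z) := by
  rw [dualVolume, measurableEmbedding_innerSL.integrable_map_iff]
  simp only [Function.comp_def, centralFourier_innerSL]
  exact (integrable_prod_angularFourier h f).integral_prod_right

theorem integral_inner_centralFourier (h f : 𝓢(Group V Z, ℂ)) :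
    ∫ lam, (∫ v, starRingEnd ℂ (centralFourier h lam v) * centralFourier f lam v) ∂dualVolume Z
      = ((2 * Real.pi) ^ Module.finrank ℝ Z : ℝ)
        * ∫ x : Group V Z, starRingEnd ℂ (h x) * f x := by
  have hf2 : ∀ g : 𝓢(Group V Z, ℂ), MemLp g 2 ((volume : Measure V).prod (volume : Measure Z)) :=
    fun g => g.memLp 2 volume
  have hi : Integrable (fun x : V × Z => starRingEnd ℂ (h x) * f x)
      ((volume : Measure V).prod volume) := (hf2 h).star.integrable_mul (hf2 f)
  rw [dualVolume, measurableEmbedding_innerSL.integral_map]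
  simp only [centralFourier_innerSL]
  rw [← integral_integral_swap (integrable_prod_angularFourier h f)]
  change _ = _ * ∫ x, starRingEnd ℂ (h x) * f x ∂((volume : Measure V).prod (volume : Measure Z))
  rw [integral_prod _ hi, ← integral_const_mul]
  refine integral_congr_ae ?_
  filter_upwards [ae_memLp_prod_right h.continuous.measurable (hf2 h),
    ae_memLp_prod_right f.continuous.measurable (hf2 f)] with v h1 h2
  exact integral_conj_angularFourier (integrable_slice h v) h1 (integrable_slice f v) h2

/-! ### The group law -/

/-- The product `x y⁻¹` of the group. -/
def LieStructure.mulInv (A : LieStructure V Z) (x y : Group V Z) : Group V Z :=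
  (x.1 - y.1, x.2 - y.2 - (1 / 2 : ℝ) • A.bracket x.1 y.1)

/-- The dilation `(v, z) ↦ (ε v, ε² z)`. -/
def dilation (ε : ℝ) (y : Group V Z) : Group V Z := (ε • y.1, ε ^ 2 • y.2)

theorem Frame.bracket_eq (e : Frame A d) {lam : Z →L[ℝ] ℝ} (hlam : lam ≠ 0) (u v : V) :
    lam (A.bracket u v)
      = ‖lam‖ * (inner ℝ (e.p lam u) (e.q lam v) - inner ℝ (e.p lam v) (e.q lam u)) := by
  conv_lhs => rw [← (e.basis lam).sum_repr u, ← (e.basis lam).sum_repr v]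
  simp only [map_sum, map_smul, LinearMap.sum_apply, LinearMap.smul_apply, smul_eq_mul,
    e.form_eq lam hlam]
  simp only [Fintype.sum_sum_type, Matrix.fromBlocks_apply₁₁, Matrix.fromBlocks_apply₁₂,
    Matrix.fromBlocks_apply₂₁, Matrix.fromBlocks_apply₂₂, Matrix.zero_apply, Matrix.neg_apply,
    Matrix.one_apply, mul_zero, Finset.sum_const_zero, mul_ite, mul_one, mul_neg, zero_add,
    add_zero, Finset.sum_ite_eq', Finset.mem_univ, if_true, neg_ite, neg_zero]
  simp only [Frame.p, Frame.q, PiLp.inner_apply, RCLike.inner_apply, conj_trivial,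
    Finset.sum_neg_distrib, ← mul_assoc, ← Finset.sum_mul]
  simp only [mul_comm (((e.basis lam).repr v).ofLp (Sum.inl _))]
  ring

theorem Frame.rep_ae (e : Frame A d) (lam : Z →L[ℝ] ℝ) (x : Group V Z) (Φ : L2 d) :
    e.rep lam x Φ =ᵐ[volume] fun ξ =>
      Complex.exp (Complex.I * (e.phase lam x ξ : ℝ)) * Φ (ξ + √‖lam‖ • e.p lam x.1) := by
  have h1 := Lp.coeFn_compMeasurePreserving (p := 2) Φ
    (measurePreserving_add_right volume (√‖lam‖ • e.p lam x.1))
  have h2 := (phase_memLp (e.phase lam x) (translate (√‖lam‖ • e.p lam x.1) Φ)).coeFn_toLp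
  have h0 : e.rep lam x Φ
    = (phase_memLp (e.phase lam x) (translate (√‖lam‖ • e.p lam x.1) Φ)).toLp := rfl
  rw [h0]
  filter_upwards [h1, h2] with ξ h1 h2
  rw [h2]
  congr 1

theorem Frame.p_sub (e : Frame A d) (lam : Z →L[ℝ] ℝ) (u v : V) :
    e.p lam (u - v) = e.p lam u - e.p lam v := by
  ext i; simp [Frame.p]

theorem Frame.q_sub (e : Frame A d) (lam : Z →L[ℝ] ℝ) (u v : V) :
    e.q lam (u - v) = e.q lam u - e.q lam v := by
  ext i; simp [Frame.q]

theorem Frame.p_smul (e : Frame A d) (lam : Z →L[ℝ] ℝ) (t : ℝ) (v : V) :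
    e.p lam (t • v) = t • e.p lam v := by
  ext i; simp [Frame.p]

theorem Frame.q_smul (e : Frame A d) (lam : Z →L[ℝ] ℝ) (t : ℝ) (v : V) :
    e.q lam (t • v) = t • e.q lam v := by
  ext i; simp [Frame.q]

theorem Frame.phase_apply (e : Frame A d) (lam : Z →L[ℝ] ℝ) (x : Group V Z) (ξ : Eucl d) :
    e.phase lam x ξ = lam x.2 + 1 / 2 * ‖lam‖ * inner ℝ (e.p lam x.1) (e.q lam x.1)
      + √‖lam‖ * inner ℝ ξ (e.q lam x.1) := rfl

/-- The translations add up, and the discrepancy of the phases is exactly `½ lam [x, y]`, which the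
frame expresses through the coordinates `p`, `q`. -/
theorem Frame.rep_mulInv (e : Frame A d) {lam : Z →L[ℝ] ℝ} (hlam : lam ≠ 0) (x y : Group V Z)
    (Φ : L2 d) : e.rep lam (A.mulInv x y) (e.rep lam y Φ) = e.rep lam x Φ := by
  apply Lp.ext
  have h2 := (measurePreserving_add_right volume
    (√‖lam‖ • e.p lam (A.mulInv x y).1)).quasiMeasurePreserving.ae_eq (e.rep_ae lam y Φ)
  filter_upwards [e.rep_ae lam (A.mulInv x y) (e.rep lam y Φ), h2, e.rep_ae lam x Φ]
    with ξ h1 h2 h3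
  simp only [Function.comp_apply] at h2
  have hr := Real.mul_self_sqrt (norm_nonneg lam)
  have hb := e.bracket_eq hlam x.1 y.1
  have k1 : e.phase lam (A.mulInv x y) ξ
      + e.phase lam y (ξ + √‖lam‖ • e.p lam (A.mulInv x y).1) = e.phase lam x ξ := by
    simp only [e.phase_apply, LieStructure.mulInv, e.p_sub, e.q_sub, map_sub, map_smul, hb,
      smul_eq_mul, inner_sub_left, inner_sub_right, inner_add_left, real_inner_smul_left]
    linear_combination (inner ℝ (e.p lam x.1) (e.q lam y.1)
      - inner ℝ (e.p lam y.1) (e.q lam y.1)) * hr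
  have k2 : ξ + √‖lam‖ • e.p lam (A.mulInv x y).1 + √‖lam‖ • e.p lam y.1
      = ξ + √‖lam‖ • e.p lam x.1 := by
    simp only [LieStructure.mulInv, e.p_sub, smul_sub]
    abel
  rw [h1, h2, h3, k2, ← mul_assoc, ← Complex.exp_add, ← mul_add, ← Complex.ofReal_add, k1]

theorem Frame.rep_rep_symm (e : Frame A d) {lam : Z →L[ℝ] ℝ} (hlam : lam ≠ 0) (x y : Group V Z)
    (Φ : L2 d) : e.rep lam x ((e.rep lam y).symm Φ) = e.rep lam (A.mulInv x y) Φ := by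
  rw [← e.rep_mulInv hlam x y, LinearIsometryEquiv.apply_symm_apply]

/-- Uses that the frame depends only on the direction of `lam`, while `√|ε² lam| = ε √|lam|`. -/
theorem Frame.rep_sq_smul (e : Frame A d) (lam : Z →L[ℝ] ℝ) {ε : ℝ} (hε : 0 < ε)
    (y : Group V Z) : e.rep (ε ^ 2 • lam) y = e.rep lam (dilation ε y) := by
  have hn : ‖ε ^ 2 • lam‖ = ε ^ 2 * ‖lam‖ := by
    rw [norm_smul, Real.norm_of_nonneg (by positivity)]
  have hs : √‖ε ^ 2 • lam‖ = ε * √‖lam‖ := by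
    rw [hn, Real.sqrt_mul (by positivity), Real.sqrt_sq hε.le]
  have hb := e.basis_smul (ε ^ 2) lam (by positivity)
  have hp : ∀ v, e.p (ε ^ 2 • lam) v = e.p lam v := fun v => by simp only [Frame.p, hb]
  have hq : ∀ v, e.q (ε ^ 2 • lam) v = e.q lam v := fun v => by simp only [Frame.q, hb]
  have h1 : e.phase (ε ^ 2 • lam) y = e.phase lam (dilation ε y) := by
    ext ξ
    rw [e.phase_apply, e.phase_apply, hs, hn]
    simp only [hp, hq, dilation, e.p_smul, e.q_smul, map_smul, smul_apply, smul_eq_mul,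
      real_inner_smul_left, real_inner_smul_right]
    ring
  have h2 : √‖ε ^ 2 • lam‖ • e.p (ε ^ 2 • lam) y.1 = √‖lam‖ • e.p lam (dilation ε y).1 := by
    simp only [hs, hp, dilation, e.p_smul, smul_smul]
    rw [mul_comm]
  unfold Frame.rep
  rw [h1, h2]

/-- The linear part `L` of the affine map `w ↦ y` that solves `x (δ_ε y)⁻¹ = w`. -/
def LieStructure.linearPart (A : LieStructure V Z) {ε : ℝ} (hε : 0 < ε) (x : Group V Z) :
    Group V Z ≃L[ℝ] Group V Z :=
  LinearEquiv.toContinuousLinearEquiv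
    { toFun := fun u => (-(ε⁻¹ • u.1), (ε ^ 2)⁻¹ • ((1 / 2 : ℝ) • A.bracket x.1 u.1 - u.2))
      map_add' := fun u w => by
        ext <;> simp only [Prod.fst_add, Prod.snd_add, map_add] <;> module
      map_smul' := fun c u => by
        ext <;> simp only [Prod.smul_fst, Prod.smul_snd, map_smul, RingHom.id_apply] <;> module
      invFun := fun y => (-(ε • y.1), -(ε ^ 2 • y.2) - (ε / 2) • A.bracket x.1 y.1)
      left_inv := fun u => by
        have := hε.ne'
        ext <;> simp only [map_neg, map_smul, smul_neg, neg_neg, smul_sub, smul_smul]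
        · simp [this]
        · rw [mul_inv_cancel₀ (by positivity), show ε ^ 2 * ((ε ^ 2)⁻¹ * (1 / 2)) = 1 / 2 by
            field_simp, show ε / 2 * ε⁻¹ = 1 / 2 by field_simp]
          module
      right_inv := fun y => by
        have := hε.ne'
        ext <;> simp only [map_neg, map_smul, smul_neg, neg_neg, smul_sub, smul_smul]
        · simp [this]
        · rw [inv_mul_cancel₀ (by positivity), show (ε ^ 2)⁻¹ * (1 / 2 * ε) = (ε ^ 2)⁻¹ * (ε / 2) by
            ring]
          module }

theorem LieStructure.mulInv_dilation (A : LieStructure V Z) {ε : ℝ} (hε : 0 < ε)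
    (x y : Group V Z) :
    A.mulInv x (dilation ε y) = x + (A.linearPart hε x).symm y := by
  change ((x.1 - ε • y.1, x.2 - ε ^ 2 • y.2 - (1 / 2 : ℝ) • A.bracket x.1 (ε • y.1)) : Group V Z)
    = (x.1 + -(ε • y.1), x.2 + (-(ε ^ 2 • y.2) - (ε / 2) • A.bracket x.1 y.1))
  ext <;> simp only [map_smul] <;> module

/-- The Jacobian of `L`. -/
def LieStructure.jacobian (A : LieStructure V Z) {ε : ℝ} (hε : 0 < ε) (x : Group V Z) : ℝ :=
  |LinearMap.det ((A.linearPart hε x : Group V Z ≃ₗ[ℝ] Group V Z) : Group V Z →ₗ[ℝ] Group V Z)|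

theorem LieStructure.integral_mulInv_dilation (A : LieStructure V Z) {ε : ℝ} (hε : 0 < ε)
    (x : Group V Z) (F : Group V Z → ℂ) :
    A.jacobian hε x * ∫ w, F w = ∫ y, F (A.mulInv x (dilation ε y)) := by
  set L := A.linearPart hε x with hL
  set D := LinearMap.det ((L.symm : Group V Z ≃ₗ[ℝ] Group V Z) : Group V Z →ₗ[ℝ] Group V Z)
    with hD
  have hD0 : D ≠ 0 := (LinearEquiv.isUnit_det' (L.symm : Group V Z ≃ₗ[ℝ] Group V Z)).ne_zero
  have h1 := Measure.map_linearMap_addHaar_eq_smul_addHaar (volume : Measure (Group V Z)) hD0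
  have h2 : D⁻¹ = LinearMap.det ((L : Group V Z ≃ₗ[ℝ] Group V Z) : Group V Z →ₗ[ℝ] Group V Z) := by
    exact inv_eq_of_mul_eq_one_right
      (LinearEquiv.det_symm_mul_det (L : Group V Z ≃ₗ[ℝ] Group V Z))
  have h3 : ∫ y, F (x + L.symm y) = ∫ u, F (x + u) ∂(Measure.map L.symm volume) :=
    (L.symm.toHomeomorph.measurableEmbedding.integral_map (fun u => F (x + u))).symm
  simp only [A.mulInv_dilation hε]
  rw [h3]
  have h4 : Measure.map L.symm (volume : Measure (Group V Z))
    = ENNReal.ofReal |D⁻¹| • volume := h1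
  rw [h4, integral_smul_measure, integral_add_left_eq_self F x,
    ENNReal.toReal_ofReal (abs_nonneg _), h2, Complex.real_smul]
  rfl

/-- The function `h` on the group whose Fourier transform is the adjoint of
`π^lam_x 𝓕 κ (ε² lam)`. -/
def LieStructure.adjointKernel (A : LieStructure V Z) {ε : ℝ} (hε : 0 < ε) (x : Group V Z)
    (κ : 𝓢(Group V Z, ℂ)) : 𝓢(Group V Z, ℂ) :=
  A.jacobian hε x • SchwartzMap.compSubConstCLM ℝ x
    (SchwartzMap.compCLMOfContinuousLinearEquiv ℝ (A.linearPart hε x)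
      (SchwartzMap.postcompCLM (Complex.conjCLE : ℂ →L[ℝ] ℂ) κ))

theorem LieStructure.adjointKernel_apply (A : LieStructure V Z) {ε : ℝ} (hε : 0 < ε)
    (x : Group V Z) (κ : 𝓢(Group V Z, ℂ)) (y : Group V Z) :
    A.adjointKernel hε x κ (A.mulInv x (dilation ε y))
      = A.jacobian hε x * starRingEnd ℂ (κ y) := by
  rw [A.mulInv_dilation hε, LieStructure.adjointKernel]
  simp

/-- The factor `A.jacobian hε x` in the kernel compensates the change of variables `w = x (δ_ε
y)⁻¹`. No integrability of `F` is needed, since the substitution is an affine bijection. -/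
theorem LieStructure.integral_adjointKernel (A : LieStructure V Z) {ε : ℝ} (hε : 0 < ε)
    (x : Group V Z) (κ : 𝓢(Group V Z, ℂ)) (F : Group V Z → ℂ) :
    ∫ w, starRingEnd ℂ (A.adjointKernel hε x κ w) * F w
      = ∫ y, κ y * F (A.mulInv x (dilation ε y)) := by
  have hj : (A.jacobian hε x : ℂ) ≠ 0 := by
    rw [Complex.ofReal_ne_zero]
    exact abs_ne_zero.2 (LinearEquiv.isUnit_det' _).ne_zero
  refine mul_left_cancel₀ hj ?_
  rw [A.integral_mulInv_dilation hε x, ← integral_const_mul]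
  refine integral_congr_ae (Eventually.of_forall fun y => ?_)
  simp only [A.adjointKernel_apply hε, map_mul, Complex.conj_ofReal, Complex.conj_conj, mul_assoc]

theorem Frame.inner_fourier_left (e : Frame A d) (lam : Z →L[ℝ] ℝ) (h : 𝓢(Group V Z, ℂ))
    (Φ Ψ : L2 d) :
    inner ℂ (e.fourier h lam Φ) Ψ = ∫ w, starRingEnd ℂ (h w) * inner ℂ Φ (e.rep lam w Ψ) := by
  have h0 : e.fourier h lam Φ = ∫ x : Group V Z, h x • (e.rep lam x).symm Φ := rfl
  rw [← inner_conj_symm, h0, ← integral_inner (e.integrable_rep_symm lam h Φ), ← integral_conj]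
  refine integral_congr_ae (Eventually.of_forall fun w => ?_)
  simp only [inner_smul_right, map_mul, inner_conj_symm]
  rw [← (e.rep lam w).inner_map_map ((e.rep lam w).symm Φ), LinearIsometryEquiv.apply_symm_apply]

/-- Expanded as integrals, the two sides have the integrands `κ(y) ⟨Φ, π^lam_x (π^lam_(δ_ε y))^* Ψ⟩`
and `conj(h(w)) ⟨Φ, π^lam_w Ψ⟩`, which correspond under `w = x (δ_ε y)⁻¹`. -/
theorem Frame.inner_rep_fourier (e : Frame A d) {lam : Z →L[ℝ] ℝ} (hlam : lam ≠ 0) {ε : ℝ}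
    (hε : 0 < ε) (x : Group V Z) (κ : 𝓢(Group V Z, ℂ)) (Φ Ψ : L2 d) :
    inner ℂ Φ (e.rep lam x (e.fourier κ (ε ^ 2 • lam) Ψ))
      = inner ℂ (e.fourier (A.adjointKernel hε x κ) lam Φ) Ψ := by
  rw [e.inner_fourier_left, A.integral_adjointKernel]
  have h0 : e.fourier κ (ε ^ 2 • lam) Ψ
    = ∫ y : Group V Z, κ y • (e.rep (ε ^ 2 • lam) y).symm Ψ := rfl
  have h1 : inner ℂ Φ (e.rep lam x (e.fourier κ (ε ^ 2 • lam) Ψ))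
      = inner ℂ ((e.rep lam x).symm Φ) (e.fourier κ (ε ^ 2 • lam) Ψ) := by
    rw [← (e.rep lam x).inner_map_map ((e.rep lam x).symm Φ), LinearIsometryEquiv.apply_symm_apply]
  rw [h1, h0, ← integral_inner (e.integrable_rep_symm _ κ Ψ)]
  refine integral_congr_ae (Eventually.of_forall fun y => ?_)
  simp only [inner_smul_right]
  rw [← (e.rep lam x).inner_map_map ((e.rep lam x).symm Φ), LinearIsometryEquiv.apply_symm_apply,
    e.rep_sq_smul lam hε, e.rep_rep_symm hlam]

/-! ### Quantization -/

theorem IsHilbertSchmidt.isometry_comp {H : Type} [NormedAddCommGroup H] [InnerProductSpace ℂ H]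
    (U : H ≃ₗᵢ[ℂ] H) {T : H →L[ℂ] H} (hT : IsHilbertSchmidt T) :
    IsHilbertSchmidt ((U : H →L[ℂ] H) ∘L T) := by
  intro ι b
  simpa using hT ι b

theorem Frame.isTraceClass_quantOp (e : Frame A d) {κ : Group V Z → 𝓢(Group V Z, ℂ)}
    {σ : Symbol V Z d} (hσ : IsConvolutionKernel e κ σ) {ε : ℝ} (hε : 0 < ε)
    (f : 𝓢(Group V Z, ℂ)) (x : Group V Z) {lam : Z →L[ℝ] ℝ} (hlam : lam ≠ 0) :
    IsTraceClass (e.quantOp σ ε f x lam) := by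
  have h0 : ε ^ 2 • lam ≠ 0 := smul_ne_zero (by positivity) hlam
  refine ⟨_, _, (e.isHilbertSchmidt_fourier h0 (κ x)).isometry_comp (e.rep lam x),
    e.isHilbertSchmidt_fourier hlam f, ?_⟩
  rw [Frame.quantOp, hσ.op_eq x _ h0, ContinuousLinearMap.comp_assoc]

theorem Frame.quantIntegrand_eq (e : Frame A d) {κ : Group V Z → 𝓢(Group V Z, ℂ)}
    {σ : Symbol V Z d} (hσ : IsConvolutionKernel e κ σ) {ε : ℝ} (hε : 0 < ε)
    (f : 𝓢(Group V Z, ℂ)) (x : Group V Z) {lam : Z →L[ℝ] ℝ} (hlam : lam ≠ 0) :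
    e.quantIntegrand σ ε f x lam = ((2 * Real.pi) ^ d : ℝ)
      * ∫ v, starRingEnd ℂ (centralFourier (A.adjointKernel hε x (κ x)) lam v)
        * centralFourier f lam v := by
  have h0 : ε ^ 2 • lam ≠ 0 := smul_ne_zero (by positivity) hlam
  have hl : ‖lam‖ ≠ 0 := norm_ne_zero_iff.2 hlam
  have ht := (e.hasSum_inner_fourier hlam (A.adjointKernel hε x (κ x)) f
    (exists_hilbertBasis ℂ (L2 d)).choose_spec.choose).tsum_eq
  have h1 : trace (e.quantOp σ ε f x lam)
      = ∑' i, inner ℂ (e.fourier (A.adjointKernel hε x (κ x)) lam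
          ((exists_hilbertBasis ℂ (L2 d)).choose_spec.choose i))
        (e.fourier f lam ((exists_hilbertBasis ℂ (L2 d)).choose_spec.choose i)) := by
    unfold trace
    refine tsum_congr fun i => ?_
    rw [Frame.quantOp, hσ.op_eq x _ h0, ← e.inner_rep_fourier hlam hε]
    rfl
  rw [Frame.quantIntegrand, h1, ht]
  have hl' : (‖lam‖ : ℂ) ^ d ≠ 0 := pow_ne_zero _ (Complex.ofReal_ne_zero.2 hl)
  push_cast
  field_simp

/-- A point is a null set only in positive dimension; this is where the nontriviality of the center
enters. -/
theorem ae_dualVolume_ne_zero [Nontrivial Z] : ∀ᵐ lam ∂dualVolume Z, lam ≠ 0 := by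
  rw [dualVolume, measurableEmbedding_innerSL.ae_map_iff]
  have : ∀ᵐ z : Z, z ≠ 0 := Measure.ae_ne volume 0
  filter_upwards [this] with z hz h
  exact hz (norm_eq_zero.1 (by rw [← innerSL_apply_norm (𝕜 := ℝ), h, norm_zero]))

theorem LieStructure.nontrivial_center (A : LieStructure V Z) : Nontrivial Z := by
  obtain ⟨u, v, h⟩ := A.nonabelian
  exact ⟨⟨_, _, h⟩⟩

theorem Frame.integrableOn_quantIntegrand (e : Frame A d) {κ : Group V Z → 𝓢(Group V Z, ℂ)}
    {σ : Symbol V Z d} (hσ : IsConvolutionKernel e κ σ) {ε : ℝ} (hε : 0 < ε)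
    (f : 𝓢(Group V Z, ℂ)) (x : Group V Z) :
    IntegrableOn (e.quantIntegrand σ ε f x) {lam | lam ≠ 0} (dualVolume Z) := by
  refine (integrableOn_congr_fun (fun lam hlam => e.quantIntegrand_eq hσ hε f x hlam)
    (measurableSet_singleton 0).compl).2 ?_
  exact ((integrable_inner_centralFourier _ f).const_mul _).integrableOn

theorem Frame.op_eq (e : Frame A d) {κ : Group V Z → 𝓢(Group V Z, ℂ)}
    {σ : Symbol V Z d} (hσ : IsConvolutionKernel e κ σ) {ε : ℝ} (hε : 0 < ε)
    (f : 𝓢(Group V Z, ℂ)) (x : Group V Z) :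
    e.Op ε σ f x = ∫ y, κ x y * f (A.mulInv x (dilation ε y)) := by
  have := A.nontrivial_center
  rw [Frame.Op, setIntegral_congr_fun (s := {lam | lam ≠ 0}) (measurableSet_singleton 0).compl
    (fun lam hlam => e.quantIntegrand_eq hσ hε f x hlam), Measure.restrict_eq_self_of_ae_mem
    (s := {lam | lam ≠ 0}) ae_dualVolume_ne_zero, integral_const_mul, integral_inner_centralFourier,
    A.integral_adjointKernel, c0, pow_add]
  have hpi : (Real.pi : ℂ) ≠ 0 := by exact_mod_cast Real.pi_ne_zero
  push_cast
  field_simp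

/-! ### The bound on `L²` -/

/-- Cauchy-Schwarz against the constant `1` for the measure of density `w`. -/
theorem sq_lintegral_mul_le {X : Type*} [MeasurableSpace X] {μ : Measure X} {w g : X → ℝ≥0∞}
    (hw : Measurable w) (hg : Measurable g) :
    (∫⁻ x, w x * g x ∂μ) ^ 2 ≤ (∫⁻ x, w x ∂μ) * ∫⁻ x, w x * g x ^ 2 ∂μ := by
  have h : ∫⁻ x, g x ∂(μ.withDensity w) ≤ (∫⁻ x, g x ^ 2 ∂(μ.withDensity w)) ^ (1 / 2 : ℝ)
      * (∫⁻ _, 1 ∂(μ.withDensity w)) ^ (1 / 2 : ℝ) := by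
    simpa using ENNReal.lintegral_mul_le_Lp_mul_Lq (μ.withDensity w)
      Real.HolderConjugate.two_two hg.aemeasurable (g := fun _ => 1) aemeasurable_const
  have e1 : ∀ F : X → ℝ≥0∞, Measurable F →
      ∫⁻ x, F x ∂(μ.withDensity w) = ∫⁻ x, w x * F x ∂μ := fun F hF =>
    lintegral_withDensity_eq_lintegral_mul μ hw hF
  rw [e1 g hg, e1 _ (hg.pow_const 2), e1 _ measurable_const] at h
  simp only [mul_one] at h
  refine (pow_le_pow_left' h 2).trans_eq ?_
  rw [mul_pow, ← ENNReal.rpow_natCast, ← ENNReal.rpow_natCast, ← ENNReal.rpow_mul,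
    ← ENNReal.rpow_mul]
  simp [mul_comm]

/-- A shear: a translation in `V`, followed over each `v` by a translation in `Z`. -/
theorem LieStructure.measurePreserving_mulInv (A : LieStructure V Z) (y : Group V Z) :
    MeasurePreserving (fun x : Group V Z => A.mulInv x y) := by
  have hc : Continuous (A.bracket.flip y.1) := LinearMap.continuous_of_finiteDimensional _
  refine MeasurePreserving.skew_product (μa := (volume : Measure V)) (μb := volume)
    (μc := (volume : Measure Z)) (μd := volume) (f := fun v : V => v - y.1)
    (g := fun v z => z - y.2 - (1 / 2 : ℝ) • A.bracket v y.1)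
    (measurePreserving_sub_right volume y.1) ?_ (Eventually.of_forall fun v => ?_)
  · have : Continuous fun x : V × Z => x.2 - y.2 - (1 / 2 : ℝ) • A.bracket.flip y.1 x.1 := by
      fun_prop
    exact this.measurable
  · simp only [sub_sub]
    exact (measurePreserving_sub_right volume _).map_eq

theorem IsSmoothCompact.continuous {κ : Group V Z → 𝓢(Group V Z, ℂ)} (hκ : IsSmoothCompact κ) :
    Continuous κ := hκ.smooth 0

theorem IsSmoothCompact.continuous_uncurry {κ : Group V Z → 𝓢(Group V Z, ℂ)}
    (hκ : IsSmoothCompact κ) : Continuous fun y : Group V Z × Group V Z => κ y.1 y.2 := by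
  have h1 : Continuous fun x => SchwartzMap.toBoundedContinuousFunctionCLM ℂ (Group V Z) ℂ (κ x) :=
    (SchwartzMap.toBoundedContinuousFunctionCLM ℂ (Group V Z) ℂ).continuous.comp hκ.continuous
  exact (h1.comp continuous_fst).eval continuous_snd

/-- A continuous seminorm is bounded along a continuous compactly supported map, so the decay is
uniform in `x`. This makes the supremum over `x` integrable, so that `normA0` is the true integral
and not a default value. -/
theorem IsSmoothCompact.exists_norm_le {κ : Group V Z → 𝓢(Group V Z, ℂ)}
    (hκ : IsSmoothCompact κ) (k : ℕ) :
    ∃ C, ∀ x y, ‖κ x y‖ ≤ C * (1 + ‖y‖) ^ (-(k : ℝ)) := by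
  obtain ⟨C, hC⟩ := ((continuous_decaySeminorm k).comp
    hκ.continuous).bounded_above_of_compact_support
      (hκ.compact.comp_left (g := decaySeminorm k) (by simp [decaySeminorm]))
  refine ⟨C, fun x y => (norm_le_decaySeminorm k (κ x) y).trans ?_⟩
  refine mul_le_mul_of_nonneg_right ?_ (by positivity)
  exact (Real.le_norm_self _).trans (hC x)

theorem IsSmoothCompact.bddAbove {κ : Group V Z → 𝓢(Group V Z, ℂ)} (hκ : IsSmoothCompact κ)
    (y : Group V Z) : BddAbove (Set.range fun x => ‖κ x y‖) := by
  obtain ⟨C, hC⟩ := hκ.exists_norm_le 0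
  exact ⟨_, by rintro _ ⟨x, rfl⟩; exact hC x y⟩

/-- An uncountable supremum of continuous functions is still lower semicontinuous. -/
theorem IsSmoothCompact.measurable_iSup {κ : Group V Z → 𝓢(Group V Z, ℂ)}
    (hκ : IsSmoothCompact κ) : Measurable fun y => ⨆ x, ‖κ x y‖ :=
  (lowerSemicontinuous_ciSup hκ.bddAbove
    fun x => (κ x).continuous.norm.lowerSemicontinuous).measurable

theorem IsSmoothCompact.integrable_iSup {κ : Group V Z → 𝓢(Group V Z, ℂ)}
    (hκ : IsSmoothCompact κ) : Integrable fun y => ⨆ x, ‖κ x y‖ := by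
  set k := Module.finrank ℝ (Group V Z) + 1 with hk
  obtain ⟨C, hC⟩ := hκ.exists_norm_le k
  refine Integrable.mono' ((integrable_one_add_norm (r := (k : ℝ)) ?_).const_mul C)
    hκ.measurable_iSup.aestronglyMeasurable (Eventually.of_forall fun y => ?_)
  · rw [hk]; push_cast; linarith
  · rw [Real.norm_of_nonneg (Real.iSup_nonneg fun x => norm_nonneg _)]
    exact ciSup_le fun x => hC x y

theorem LieStructure.continuous_mulInv_dilation (A : LieStructure V Z) (ε : ℝ) :
    Continuous fun y : Group V Z × Group V Z => A.mulInv y.1 (dilation ε y.2) := by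
  have hb : Continuous fun y : V × V => A.bracket y.1 y.2 := by
    have h0 : Continuous fun u => LinearMap.toContinuousLinearMap (A.bracket u) :=
      LinearMap.continuous_of_finiteDimensional
        ((LinearMap.toContinuousLinearMap (𝕜 := ℝ) (E := V) (F' := Z)).toLinearMap ∘ₗ A.bracket)
    exact (h0.comp continuous_fst).clm_apply continuous_snd
  have h1 : Continuous fun y : Group V Z × Group V Z => A.bracket y.1.1 (ε • y.2.1) :=
    hb.comp (g := fun y : V × V => A.bracket y.1 y.2)
      (f := fun y : Group V Z × Group V Z => (y.1.1, ε • y.2.1)) (by fun_prop)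
  unfold LieStructure.mulInv dilation
  fun_prop

/-- The operator `f ↦ ∫ κ_x(y) f(x (δ_ε y)⁻¹) dy`. -/
def LieStructure.convolution (A : LieStructure V Z) (ε : ℝ) (κ : Group V Z → 𝓢(Group V Z, ℂ))
    (f : 𝓢(Group V Z, ℂ)) (x : Group V Z) : ℂ :=
  ∫ y, κ x y * f (A.mulInv x (dilation ε y))

theorem LieStructure.stronglyMeasurable_convolution (A : LieStructure V Z) (ε : ℝ)
    {κ : Group V Z → 𝓢(Group V Z, ℂ)} (hκ : IsSmoothCompact κ) (f : 𝓢(Group V Z, ℂ)) :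
    StronglyMeasurable (A.convolution ε κ f) := by
  unfold LieStructure.convolution
  refine StronglyMeasurable.integral_prod_right
    (f := fun x y => κ x y * f (A.mulInv x (dilation ε y))) ?_
  have : Continuous fun y : Group V Z × Group V Z =>
      κ y.1 y.2 * f (A.mulInv y.1 (dilation ε y.2)) :=
    hκ.continuous_uncurry.mul (f.continuous.comp (A.continuous_mulInv_dilation ε))
  exact this.stronglyMeasurable

theorem LieStructure.integrable_convolution (A : LieStructure V Z) (ε : ℝ)
    (κ : 𝓢(Group V Z, ℂ)) (f : 𝓢(Group V Z, ℂ)) (x : Group V Z) :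
    Integrable fun y => κ y * f (A.mulInv x (dilation ε y)) := by
  refine κ.integrable.mul_bdd (c := SchwartzMap.seminorm ℝ 0 0 f) ?_
    (Eventually.of_forall fun y => f.norm_le_seminorm ℝ _)
  exact (f.continuous.comp ((A.continuous_mulInv_dilation ε).comp
    (Continuous.prodMk_right x))).aestronglyMeasurable

/-- One factor of the norm is the total mass of the weight in Cauchy-Schwarz. The other appears
after Tonelli, when the integral over `x` at fixed `y` no longer depends on `y`. -/
theorem LieStructure.lintegral_convolution_sq_le (A : LieStructure V Z) (ε : ℝ)
    {κ : Group V Z → 𝓢(Group V Z, ℂ)} (hκ : IsSmoothCompact κ) (f : 𝓢(Group V Z, ℂ)) :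
    ∫⁻ x, ‖A.convolution ε κ f x‖ₑ ^ 2
      ≤ ENNReal.ofReal (normA0 κ) ^ 2 * ∫⁻ x, ‖f x‖ₑ ^ 2 := by
  set w : Group V Z → ℝ≥0∞ := fun y => ENNReal.ofReal (⨆ x, ‖κ x y‖) with hw
  have hwm : Measurable w := hκ.measurable_iSup.ennreal_ofReal
  have hwi : ∫⁻ y, w y = ENNReal.ofReal (normA0 κ) :=
    (ofReal_integral_eq_lintegral_ofReal hκ.integrable_iSup
      (Eventually.of_forall fun y => Real.iSup_nonneg fun x => norm_nonneg _)).symm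
  have hfm : Measurable fun y : Group V Z × Group V Z =>
      ‖f (A.mulInv y.1 (dilation ε y.2))‖ₑ :=
    (f.continuous.comp (A.continuous_mulInv_dilation ε)).measurable.enorm
  have hx : ∀ x, ‖A.convolution ε κ f x‖ₑ ^ 2 ≤ ENNReal.ofReal (normA0 κ)
      * ∫⁻ y, w y * ‖f (A.mulInv x (dilation ε y))‖ₑ ^ 2 := by
    intro x
    rw [← hwi]
    refine le_trans (pow_le_pow_left' ?_ 2) (sq_lintegral_mul_le hwm (hfm.comp measurable_prodMk_left))
    refine (enorm_integral_le_lintegral_enorm _).trans (lintegral_mono fun y => ?_)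
    rw [enorm_mul]
    gcongr
    rw [← ofReal_norm]
    exact ENNReal.ofReal_le_ofReal (le_ciSup (hκ.bddAbove y) x)
  refine (lintegral_mono hx).trans ?_
  rw [lintegral_const_mul' _ _ ENNReal.ofReal_ne_top, sq, mul_assoc]
  gcongr
  rw [lintegral_lintegral_swap
    ((hwm.comp measurable_snd).mul (hfm.pow_const 2)).aemeasurable, ← hwi,
    ← lintegral_mul_const _ hwm]
  refine lintegral_mono fun y => ?_
  rw [lintegral_const_mul' _ _ ENNReal.ofReal_ne_top]
  have := (A.measurePreserving_mulInv (dilation ε y)).lintegral_comp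
    (f := fun x => ‖f x‖ₑ ^ 2) (f.continuous.measurable.enorm.pow_const 2)
  rw [this]

theorem LieStructure.memLp_convolution (A : LieStructure V Z) (ε : ℝ)
    {κ : Group V Z → 𝓢(Group V Z, ℂ)} (hκ : IsSmoothCompact κ) (f : 𝓢(Group V Z, ℂ)) :
    MemLp (A.convolution ε κ f) 2 := by
  refine memLp_two_iff.2 ⟨(A.stronglyMeasurable_convolution ε hκ f).aestronglyMeasurable, ?_⟩
  refine (A.lintegral_convolution_sq_le ε hκ f).trans_lt (ENNReal.mul_lt_top ?_ ?_)
  · exact ENNReal.pow_lt_top ENNReal.ofReal_lt_top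
  · exact (memLp_two_iff.1 (f.memLp 2 volume)).2

/-- The map `f ↦ ∫ κ_x(y) f(x (δ_ε y)⁻¹) dy` from the Schwartz space to `L²(G)`. -/
def LieStructure.convolutionLp (A : LieStructure V Z) (ε : ℝ)
    {κ : Group V Z → 𝓢(Group V Z, ℂ)} (hκ : IsSmoothCompact κ) :
    𝓢(Group V Z, ℂ) →ₗ[ℂ] Lp ℂ 2 (volume : Measure (Group V Z)) where
  toFun f := (A.memLp_convolution ε hκ f).toLp
  map_add' f g := by
    rw [← MemLp.toLp_add]
    congr 1
    funext x
    simp only [Pi.add_apply, LieStructure.convolution]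
    rw [← integral_add (A.integrable_convolution ε (κ x) f x) (A.integrable_convolution ε (κ x) g x)]
    simp only [add_apply, mul_add]
  map_smul' c f := by
    rw [RingHom.id_apply, ← MemLp.toLp_const_smul]
    congr 1
    funext x
    simp only [Pi.smul_apply, LieStructure.convolution]
    rw [← integral_smul]
    simp only [smul_apply, smul_eq_mul, mul_left_comm]

theorem normA0_nonneg (κ : Group V Z → 𝓢(Group V Z, ℂ)) : 0 ≤ normA0 κ :=
  integral_nonneg fun _ => Real.iSup_nonneg fun _ => norm_nonneg _

theorem LieStructure.norm_convolutionLp_le (A : LieStructure V Z) (ε : ℝ)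
    {κ : Group V Z → 𝓢(Group V Z, ℂ)} (hκ : IsSmoothCompact κ) (f : 𝓢(Group V Z, ℂ)) :
    ‖A.convolutionLp ε hκ f‖ ≤ normA0 κ * ‖f.toLp 2 (volume : Measure (Group V Z))‖ := by
  have h := A.lintegral_convolution_sq_le ε hκ f
  rw [MemLp.lintegral_enorm_sq_eq (A.memLp_convolution ε hκ f),
    MemLp.lintegral_enorm_sq_eq (f.memLp 2 volume),
    ← ENNReal.ofReal_pow (normA0_nonneg κ), ← ENNReal.ofReal_mul (by positivity),
    ENNReal.ofReal_le_ofReal_iff (by positivity), ← mul_pow] at h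
  exact le_of_sq_le_sq h (mul_nonneg (normA0_nonneg κ) (norm_nonneg _))

theorem LieStructure.exists_extension_convolutionLp (A : LieStructure V Z) (ε : ℝ)
    {κ : Group V Z → 𝓢(Group V Z, ℂ)} (hκ : IsSmoothCompact κ) :
    ∃ T : Lp ℂ 2 (volume : Measure (Group V Z)) →L[ℂ] Lp ℂ 2 (volume : Measure (Group V Z)),
      (∀ f : 𝓢(Group V Z, ℂ), T (f.toLp 2) = A.convolutionLp ε hκ f) ∧ ‖T‖ ≤ normA0 κ := by
  let e : 𝓢(Group V Z, ℂ) →ₗ[ℂ] Lp ℂ 2 (volume : Measure (Group V Z)) :=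
    (SchwartzMap.toLpCLM ℂ ℂ 2 (volume : Measure (Group V Z))).toLinearMap
  have hdense : DenseRange e := SchwartzMap.denseRange_toLpCLM (E := Group V Z) (F := ℂ) (p := 2)
    (μ := (volume : Measure (Group V Z))) ENNReal.ofNat_ne_top
  have hbound : ∀ f, ‖A.convolutionLp ε hκ f‖ ≤ normA0 κ * ‖e f‖ := A.norm_convolutionLp_le ε hκ
  refine ⟨(A.convolutionLp ε hκ).extendOfNorm e, fun f => ?_, ?_⟩
  · exact LinearMap.extendOfNorm_eq hdense ⟨_, hbound⟩ f
  · exact LinearMap.opNorm_extendOfNorm_le hdense (normA0_nonneg κ) hbound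

end HType

end

theorem mainTheorem5 {V Z : Type*}
    [NormedAddCommGroup V] [InnerProductSpace ℝ V] [FiniteDimensional ℝ V]
    [MeasurableSpace V] [BorelSpace V]
    [NormedAddCommGroup Z] [InnerProductSpace ℝ Z] [FiniteDimensional ℝ Z]
    [MeasurableSpace Z] [BorelSpace Z]
    (A : HType.LieStructure V Z) (d : ℕ) :
    ∃ C : ℝ, 0 < C ∧ ∀ (e : HType.Frame A d) (σ : HType.Symbol V Z d)
      (κ : HType.Group V Z → 𝓢(HType.Group V Z, ℂ)), HType.IsConvolutionKernel e κ σ →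
      ∀ ε : ℝ, 0 < ε →
        (∀ (f : 𝓢(HType.Group V Z, ℂ)) (x : HType.Group V Z),
          (∀ lam : Z →L[ℝ] ℝ, lam ≠ 0 → HType.IsTraceClass (e.quantOp σ ε f x lam)) ∧
          IntegrableOn (e.quantIntegrand σ ε f x) {lam | lam ≠ 0} (HType.dualVolume Z)) ∧
        ∃ T : Lp ℂ 2 (volume : Measure (HType.Group V Z)) →L[ℂ]
            Lp ℂ 2 (volume : Measure (HType.Group V Z)),
          (∀ f : 𝓢(HType.Group V Z, ℂ), T (f.toLp 2) =ᵐ[volume] e.Op ε σ f) ∧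
          ‖T‖ ≤ C * HType.normA0 κ := by
  -- The weighted Cauchy-Schwarz bound loses no constant.
  refine ⟨1, one_pos, fun e σ κ hσ ε hε => ⟨fun f x =>
    ⟨fun lam hlam => e.isTraceClass_quantOp hσ hε f x hlam,
      e.integrableOn_quantIntegrand hσ hε f x⟩, ?_⟩⟩
  have hκ := hσ.smooth_compact
  obtain ⟨T, hT, hTn⟩ := A.exists_extension_convolutionLp ε hκ
  refine ⟨T, fun f => ?_, by rwa [one_mul]⟩
  have h2 : e.Op ε σ f = A.convolution ε κ f := funext fun x => e.op_eq hσ hε f x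
  rw [h2, hT]
  exact (A.memLp_convolution ε hκ f).coeFn_toLp
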